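/- Let $G$ be a finite simple graph with vertex set $V(G)=\{u_1,\dots,u_n\}$, where $n\ge 3$, let $m$ be its number of edges, and let $r$ be a restraint on $G$, i.e. a function assigning to every vertex $v$ a finite set $r(v)\subset\{1,2,3,\dots\}$ of forbidden colours. For an integer $x\ge 0$ let $\pi_r(G,x)$ be the number of functions $c:V(G)\to\{1,\dots,x\}$ such that $c(u)\ne c(v)$ for every edge $uv$ and $c(v)\notin r(v)$ for every vertex $v$. Let $M_{G,r}$ be the largest element of $\bigcup_v r(v)$, or $0$ if this union is empty. Let $N(u)$ denote the neighbourhood of $u$, $\eta_G(H)$ the number of subgraphs of $G$ isomorphic to $H$, and $i_G(H)$ the number of induced subgraphs of $G$ isomorphic to $H$. **Theorem.** There are unique integers $a_0(G,r),\dots,a_n(G,r)$ such that $\pi_r(G,x)=\sum_{i=0}^n(-1)^{n-i}a_i(G,r)\,x^i$ for all integers $x\ge M_{G,r}$, and $$a_{n-3}(G,r)=A_0(G)+\sum_{i=1}^{8}A_i(G,r),$$ where (sums over $u_iu_j\in E(G)$ run once over each edge) $$\begin{aligned} A_0(G)&=\binom m3-(m-2)\,\eta_G(C_3)-i_G(C_4)+2\,\eta_G(K_4),\\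 A_1(G,r)&=\sum_{i<j<k}|r(u_i)|\,|r(u_j)|\,|r(u_k)|,\\ A_2(G,r)&=(m-1)\sum_{i<j}|r(u_i)|\,|r(u_j)|,\\ A_3(G,r)&=\sum_{i<j,\ u_iu_j\notin E(G)}|r(u_i)|\,|r(u_j)|,\\ A_4(G,r)&=-\sum_{u_iu_j\in E(G)}|r(u_i)\cap r(u_j)|\sum_{k\notin\{i,j\}}|r(u_k)|,\\ A_5(G,r)&=\Bigl(\binom m2-\eta_G(C_3)\Bigr)\sum_{i}|r(u_i)|,\\ A_6(G,r)&=-(m-1)\sum_{u_iu_j\in E(G)}|r(u_i)\cap r(u_j)|,\\ A_7(G,r)&=\sum_{u_iu_j\in E(G)}|N(u_i)\cap N(u_j)|\,|r(u_i)\cap r(u_j)|-\sum_{i}\ \sum_{j<k,\ u_j,u_k\in N(u_i)}|r(u_j)\cap r(u_k)|,\\ A_8(G,r)&=\frac12\sum_{u_iu_j\in E(G)}\ \sum_{k\notin\{i,j\},\ u_k\in N(u_i)\cup N(u_j)}|r(u_i)\cap r(u_j)\cap r(u_k)|+\frac16\sum_{u_iu_j\in E(G)}\ \sum_{u_k\in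 N(u_i)\cap N(u_j)}|r(u_i)\cap r(u_j)\cap r(u_k)|. \end{aligned}$$ -/

import Mathlib

namespace RestrainedColouring

section Colourings

variable {V : Type*} [Fintype V] [DecidableEq V]

/-- The proper `x`-colourings of `G`, with colours `1, …, x`, that are permitted by the
restraint `r` (which lists the finite set `r v` of forbidden colours at each vertex `v`). -/
def permittedColourings (G : SimpleGraph V) [DecidableRel G.Adj] (r : V → Finset ℕ) (x : ℕ) :
    Finset (V → ℕ) :=
  (Fintype.piFinset fun _ : V => Finset.Icc 1 x).filter fun c =>
    (∀ u v, G.Adj u v → c u ≠ c v) ∧ ∀ v, c v ∉ r v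

/-- `π_r(G, x)`: the number of proper `x`-colourings of `G` permitted by `r`. -/
def restrainedCount (G : SimpleGraph V) [DecidableRel G.Adj] (r : V → Finset ℕ) (x : ℕ) : ℕ :=
  (permittedColourings G r x).card

/-- `M_{G,r}`: the largest colour in `⋃ v, r v`, and `0` if that union is empty. -/
def maxForbidden (r : V → Finset ℕ) : ℕ :=
  (Finset.univ.biUnion r).sup id

/-- `π_r(G, x) = ∑_{i=0}^n (-1)^(n-i) a_i x^i` for all `x ≥ M_{G,r}`, where `n` is the number of
vertices of `G`. -/
def HasCoefficients (G : SimpleGraph V) [DecidableRel G.Adj] (r : V → Finset ℕ)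
    (a : Fin (Fintype.card V + 1) → ℤ) : Prop :=
  ∀ x : ℕ, maxForbidden r ≤ x →
    (restrainedCount G r x : ℤ) =
      ∑ i : Fin (Fintype.card V + 1), (-1) ^ (Fintype.card V - (i : ℕ)) * a i * (x : ℤ) ^ (i : ℕ)

end Colourings

/-- `i_G(H)`: the number of induced subgraphs of `G` isomorphic to `H`; an induced subgraph is
determined by its vertex set. -/
noncomputable def inducedCount {V W : Type*} (G : SimpleGraph V) (H : SimpleGraph W) : ℕ :=
  {S : Set V | Nonempty (G.induce S ≃g H)}.ncard

section Formula

/-! The order on `V` is an enumeration `u_1 < u_2 < ⋯ < u_n` of the vertices. A sum over the edges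
`u_i u_j` of `G` is written as a sum over the pairs `i < j` that are adjacent. `G.copyCount H` is
the number `η_G(H)` of subgraphs of `G` isomorphic to `H`. -/

variable {V : Type*} [Fintype V] [LinearOrder V]

/-- `A_0 = C(m, 3) - (m - 2) η_G(C_3) - i_G(C_4) + 2 η_G(K_4)`. -/
noncomputable def A0 (G : SimpleGraph V) [DecidableRel G.Adj] : ℚ :=
  (G.edgeFinset.card.choose 3 : ℚ)
    - ((G.edgeFinset.card : ℚ) - 2) * (G.copyCount (SimpleGraph.cycleGraph 3) : ℚ)
    - (inducedCount G (SimpleGraph.cycleGraph 4) : ℚ)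
    + 2 * (G.copyCount (SimpleGraph.completeGraph (Fin 4)) : ℚ)

/-- `A_1 = ∑_{i<j<k} |r(u_i)| |r(u_j)| |r(u_k)|`. -/
def A1 (r : V → Finset ℕ) : ℚ :=
  ∑ i, ∑ j with i < j, ∑ k with j < k,
    ((r i).card : ℚ) * ((r j).card : ℚ) * ((r k).card : ℚ)

/-- `A_2 = (m - 1) ∑_{i<j} |r(u_i)| |r(u_j)|`. -/
def A2 (G : SimpleGraph V) [DecidableRel G.Adj] (r : V → Finset ℕ) : ℚ :=
  ((G.edgeFinset.card : ℚ) - 1) * ∑ i, ∑ j with i < j, ((r i).card : ℚ) * ((r j).card : ℚ)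

/-- `A_3 = ∑_{i<j, u_i u_j ∉ E(G)} |r(u_i)| |r(u_j)|`. -/
def A3 (G : SimpleGraph V) [DecidableRel G.Adj] (r : V → Finset ℕ) : ℚ :=
  ∑ i, ∑ j with i < j ∧ ¬ G.Adj i j, ((r i).card : ℚ) * ((r j).card : ℚ)

/-- `A_4 = - ∑_{u_i u_j ∈ E(G)} |r(u_i) ∩ r(u_j)| ∑_{k ∉ {i,j}} |r(u_k)|`. -/
def A4 (G : SimpleGraph V) [DecidableRel G.Adj] (r : V → Finset ℕ) : ℚ :=
  -∑ i, ∑ j with i < j ∧ G.Adj i j,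
    ((r i ∩ r j).card : ℚ) * ∑ k with k ≠ i ∧ k ≠ j, ((r k).card : ℚ)

/-- `A_5 = (C(m, 2) - η_G(C_3)) ∑_i |r(u_i)|`. -/
noncomputable def A5 (G : SimpleGraph V) [DecidableRel G.Adj] (r : V → Finset ℕ) : ℚ :=
  ((G.edgeFinset.card.choose 2 : ℚ) - (G.copyCount (SimpleGraph.cycleGraph 3) : ℚ)) *
    ∑ i, ((r i).card : ℚ)

/-- `A_6 = - (m - 1) ∑_{u_i u_j ∈ E(G)} |r(u_i) ∩ r(u_j)|`. -/
def A6 (G : SimpleGraph V) [DecidableRel G.Adj] (r : V → Finset ℕ) : ℚ :=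
  -((G.edgeFinset.card : ℚ) - 1) * ∑ i, ∑ j with i < j ∧ G.Adj i j, ((r i ∩ r j).card : ℚ)

/-- `A_7' = ∑_{u_i u_j ∈ E(G)} |N(u_i) ∩ N(u_j)| |r(u_i) ∩ r(u_j)|`. -/
def A7' (G : SimpleGraph V) [DecidableRel G.Adj] (r : V → Finset ℕ) : ℚ :=
  ∑ i, ∑ j with i < j ∧ G.Adj i j,
    ((G.neighborFinset i ∩ G.neighborFinset j).card : ℚ) * ((r i ∩ r j).card : ℚ)

/-- `A_7'' = - ∑_i ∑_{j<k, u_j, u_k ∈ N(u_i)} |r(u_j) ∩ r(u_k)|`. -/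
def A7'' (G : SimpleGraph V) [DecidableRel G.Adj] (r : V → Finset ℕ) : ℚ :=
  -∑ i, ∑ j ∈ G.neighborFinset i, ∑ k ∈ G.neighborFinset i with j < k, ((r j ∩ r k).card : ℚ)

/-- `A_7 = A_7' + A_7''`. -/
def A7 (G : SimpleGraph V) [DecidableRel G.Adj] (r : V → Finset ℕ) : ℚ :=
  A7' G r + A7'' G r

/-- `A_8' = 1/2 ∑_{u_i u_j ∈ E(G)} ∑_{k ∉ {i,j}, u_k ∈ N(u_i) ∪ N(u_j)} |r(u_i) ∩ r(u_j) ∩ r(u_k)|`.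
-/
def A8' (G : SimpleGraph V) [DecidableRel G.Adj] (r : V → Finset ℕ) : ℚ :=
  1 / 2 * ∑ i, ∑ j with i < j ∧ G.Adj i j,
    ∑ k ∈ G.neighborFinset i ∪ G.neighborFinset j with k ≠ i ∧ k ≠ j,
      ((r i ∩ r j ∩ r k).card : ℚ)

/-- `A_8'' = 1/6 ∑_{u_i u_j ∈ E(G)} ∑_{u_k ∈ N(u_i) ∩ N(u_j)} |r(u_i) ∩ r(u_j) ∩ r(u_k)|`. -/
def A8'' (G : SimpleGraph V) [DecidableRel G.Adj] (r : V → Finset ℕ) : ℚ :=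
  1 / 6 * ∑ i, ∑ j with i < j ∧ G.Adj i j,
    ∑ k ∈ G.neighborFinset i ∩ G.neighborFinset j, ((r i ∩ r j ∩ r k).card : ℚ)

/-- `A_8 = A_8' + A_8''`. -/
def A8 (G : SimpleGraph V) [DecidableRel G.Adj] (r : V → Finset ℕ) : ℚ :=
  A8' G r + A8'' G r

end Formula

end RestrainedColouring

/-!
Expand `log (π_r(G, x) / x ^ n)` in powers of `1 / x`. Its coefficients, the cumulants `κ₁, κ₂, κ₃`
up to sign, are sums of local contributions of vertices, edges, paths with two edges, triangles,
copies of `K₄` and induced copies of `C₄`, whereas `a_{n-3} = κ₁ ^ 3 / 6 - κ₁ * κ₂ + κ₃` mixes them.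

The cumulants are determined by colouring one vertex first. If all forbidden colours are at most
`M`, then the `x - M` colours above `M` all leave equivalent counting problems on `G` minus the
vertex, so the count is `(x - M) * B(x) + S(x)`, where `S` sums over the old colours that the vertex
may take. The cumulants of this polynomial are determined by those of `B`, by the number of colours
forbidden at the vertex, and by the differences between the cumulants of `B` and of the summands of
`S`, which are local because a colour changes only the restraints of the neighbours. The explicit
local sums satisfy the same recursion.
-/

namespace RestrainedColouring

open Finset

local notation "𝐀[" G "]" => SimpleGraph.adjMatrix ℚ G

section Weights

variable {V : Type*} (r : V → Finset ℕ)

/-- The contribution of the edge `ij` to the third cumulant `κ₃`, to be averaged over the two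
orientations of the edge. -/
def edgeWeight (i j : V) : ℚ := #(r i ∩ r j) * (#(r i) + #(r j)) - #(r i) * #(r j) + #(r j)

/-- Minus the contribution of the path `jik` to the third cumulant `κ₃`. -/
def cherryWeight (i j k : V) : ℚ := #(r j ∩ r k) - #(r i ∩ r j ∩ r k)

/-- The contribution of the triangle `ijk` to the third cumulant `κ₃`, to be summed over the six
orderings of its vertices. -/
def triangleWeight (i j k : V) : ℚ := #(r j ∩ r k) / 2 - #(r i ∩ r j ∩ r k) / 6

variable {W : Type*} (s : W → Finset ℕ) (φ : V → W) (i j k : V)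

lemma edgeWeight_comp : edgeWeight (s ∘ φ) i j = edgeWeight s (φ i) (φ j) := rfl

lemma cherryWeight_comp : cherryWeight (s ∘ φ) i j k = cherryWeight s (φ i) (φ j) (φ k) := rfl

lemma triangleWeight_comp : triangleWeight (s ∘ φ) i j k = triangleWeight s (φ i) (φ j) (φ k) := rfl

end Weights

section Cumulants

variable {V : Type*} [Fintype V] (G : SimpleGraph V) [DecidableRel G.Adj] (r : V → Finset ℕ)

/-- The number of edges of `G`, as a sum over ordered pairs of vertices. -/
def edgeSum : ℚ := 1 / 2 * ∑ i, ∑ j, 𝐀[G] i j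

/-- The number of triangles of `G`, as a sum over ordered triples of vertices. -/
def triangleSum : ℚ := 1 / 6 * ∑ i, ∑ j, ∑ k, 𝐀[G] i j * 𝐀[G] i k * 𝐀[G] j k

/-- The number of subgraphs `K₄` of `G`, as a sum over ordered quadruples of vertices. -/
def fourCliqueSum : ℚ :=
  1 / 24 * ∑ i, ∑ j, ∑ k, ∑ l, 𝐀[G] i j * 𝐀[G] i k * 𝐀[G] i l * (𝐀[G] j k * 𝐀[G] j l * 𝐀[G] k l)

/-- The number of induced subgraphs `C₄` of `G`, as a sum over ordered quadruples `(i, j, k, l)`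
in which `i, j` and `k, l` are the two pairs of opposite vertices. -/
def inducedFourCycleSum [DecidableEq V] : ℚ :=
  1 / 8 * ∑ i, ∑ j, ∑ k, ∑ l, 𝐀[Gᶜ] i j * 𝐀[Gᶜ] k l * (𝐀[G] i k * 𝐀[G] i l * 𝐀[G] j k * 𝐀[G] j l)

/-- The first of the three leading coefficients `κ₁, κ₂, κ₃` in the expansion
`log (π_r(G, x) / x ^ n) = -κ₁ / x - κ₂ / x ^ 2 - κ₃ / x ^ 3 - ⋯`. -/
def cumulantOne : ℚ := edgeSum G + ∑ i, (#(r i) : ℚ)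

/-- The coefficient `κ₂` of the expansion described at `cumulantOne`. -/
def cumulantTwo : ℚ :=
  edgeSum G / 2 + triangleSum G + 1 / 2 * ∑ i, (#(r i) : ℚ) ^ 2
    + 1 / 2 * ∑ i, ∑ j, 𝐀[G] i j * #(r i ∩ r j)

/-- The coefficient `κ₃` of the expansion described at `cumulantOne`. -/
def cumulantThree [DecidableEq V] : ℚ :=
  edgeSum G / 3 + 2 * triangleSum G - inducedFourCycleSum G + 2 * fourCliqueSum G
    + 1 / 3 * ∑ i, (#(r i) : ℚ) ^ 3
    + 1 / 2 * ∑ i, ∑ j, 𝐀[G] i j * edgeWeight r i j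
    - 1 / 2 * ∑ i, ∑ j, ∑ k, 𝐀[G] i j * 𝐀[G] i k * cherryWeight r i j k
    + ∑ i, ∑ j, ∑ k, 𝐀[G] i j * 𝐀[G] i k * 𝐀[G] j k * triangleWeight r i j k

end Cumulants

section AdjacencyMatrix

variable {V : Type*} (G : SimpleGraph V) [DecidableRel G.Adj]

lemma adjMatrix_symm (i j : V) : 𝐀[G] i j = 𝐀[G] j i :=
  G.isSymm_adjMatrix.apply j i

lemma adjMatrix_mul_self (i j : V) : 𝐀[G] i j * 𝐀[G] i j = 𝐀[G] i j := by
  simp [SimpleGraph.adjMatrix_apply]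

lemma adjMatrix_self (i : V) : 𝐀[G] i i = 0 := by
  simp [SimpleGraph.adjMatrix_apply]

lemma adjMatrix_compl [DecidableEq V] (i j : V) :
    𝐀[Gᶜ] i j = 1 - (if i = j then 1 else 0) - 𝐀[G] i j := by
  by_cases hij : i = j
  · subst hij; simp [SimpleGraph.adjMatrix_apply]
  · by_cases h : G.Adj i j <;> simp [SimpleGraph.adjMatrix_apply, hij, h]

end AdjacencyMatrix

section OptionSums

variable {α : Type*} [Fintype α]

lemma sum_option_three (f : Option α → Option α → Option α → ℚ) :
    ∑ i, ∑ j, ∑ k, f i j k = (∑ i, ∑ j, ∑ k, f (some i) (some j) (some k))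
      + (∑ i, ∑ j, (f none (some i) (some j) + f (some i) none (some j)
          + f (some i) (some j) none))
      + (∑ i, (f none none (some i) + f none (some i) none + f (some i) none none))
      + f none none none := by
  simp only [Fintype.sum_option, sum_add_distrib]
  ring

lemma sum_option_four {f : Option α → Option α → Option α → Option α → ℚ}
    (h₁₂ : ∀ k l, f none none k l = 0) (h₁₃ : ∀ j l, f none j none l = 0)
    (h₁₄ : ∀ j k, f none j k none = 0) (h₂₃ : ∀ i l, f i none none l = 0)
    (h₂₄ : ∀ i k, f i none k none = 0) (h₃₄ : ∀ i j, f i j none none = 0) :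
    ∑ i, ∑ j, ∑ k, ∑ l, f i j k l =
      (∑ i, ∑ j, ∑ k, ∑ l, f (some i) (some j) (some k) (some l))
      + ∑ i, ∑ j, ∑ k, (f none (some i) (some j) (some k) + f (some i) none (some j) (some k)
          + f (some i) (some j) none (some k) + f (some i) (some j) (some k) none) := by
  simp only [Fintype.sum_option, sum_add_distrib, h₁₂, h₁₃, h₁₄, h₂₃, h₂₄, h₃₄, sum_const_zero]
  ring

lemma sum_sum_congr_symm {f g : α → α → ℚ} (h : ∀ i j, f i j + f j i = g i j + g j i) :
    ∑ i, ∑ j, f i j = ∑ i, ∑ j, g i j := by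
  have hsymm : ∀ f : α → α → ℚ, ∑ i, ∑ j, (f i j + f j i) = 2 * ∑ i, ∑ j, f i j := fun f => by
    simp only [sum_add_distrib]
    rw [sum_comm (f := fun i j => f j i)]
    ring
  have hfg := hsymm f
  simp only [h, hsymm] at hfg
  linarith

end OptionSums

section VertexDeletion

variable {α : Type*} (G : SimpleGraph (Option α)) [DecidableRel G.Adj]

lemma adjMatrix_comap_some (i j : α) :
    𝐀[G.comap some] i j = 𝐀[G] (some i) (some j) := rfl

lemma compl_adjMatrix_comap_some [DecidableEq α] (i j : α) :
    𝐀[(G.comap some)ᶜ] i j = 𝐀[Gᶜ] (some i) (some j) := by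
  simp only [adjMatrix_compl, adjMatrix_comap_some, Option.some_inj]

variable [Fintype α]

lemma sum_adjMatrix_option (F : Option α → Option α → ℚ) :
    ∑ i, ∑ j, 𝐀[G] i j * F i j =
      (∑ i, ∑ j, 𝐀[G] (some i) (some j) * F (some i) (some j))
      + ∑ i, 𝐀[G] none (some i) * (F none (some i) + F (some i) none) := by
  simp only [Fintype.sum_option, adjMatrix_self, adjMatrix_symm G _ none, sum_add_distrib, mul_add]
  ring

lemma sum_adjMatrix_cherry_option (F : Option α → Option α → Option α → ℚ) :
    ∑ i, ∑ j, ∑ k, 𝐀[G] i j * 𝐀[G] i k * F i j k =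
      (∑ i, ∑ j, ∑ k, 𝐀[G] (some i) (some j) * 𝐀[G] (some i) (some k) *
        F (some i) (some j) (some k))
      + (∑ i, ∑ j, (𝐀[G] none (some i) * 𝐀[G] none (some j) * F none (some i) (some j)
          + 𝐀[G] (some i) (some j) * 𝐀[G] none (some i) *
            (F (some i) none (some j) + F (some i) (some j) none)))
      + ∑ i, 𝐀[G] none (some i) * F (some i) none none := by
  simp only [Fintype.sum_option, adjMatrix_self, adjMatrix_symm G _ none, adjMatrix_mul_self,
    sum_add_distrib, mul_add, zero_mul, mul_zero, sum_const_zero,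
    mul_comm (𝐀[G] none _) (𝐀[G] (some _) _)]
  ring

lemma sum_adjMatrix_triangle_option (F : Option α → Option α → Option α → ℚ) :
    ∑ i, ∑ j, ∑ k, 𝐀[G] i j * 𝐀[G] i k * 𝐀[G] j k * F i j k =
      (∑ i, ∑ j, ∑ k, 𝐀[G] (some i) (some j) * 𝐀[G] (some i) (some k) *
        𝐀[G] (some j) (some k) * F (some i) (some j) (some k))
      + ∑ i, ∑ j, 𝐀[G] (some i) (some j) * (𝐀[G] none (some i) * 𝐀[G] none (some j)) *
          (F none (some i) (some j) + F (some i) none (some j) + F (some i) (some j) none) := by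
  have hterm : ∀ a b c x y z : ℚ, b * c * a * x + b * a * c * y + a * b * c * z =
      a * (b * c) * (x + y + z) := by
    intros; ring
  simp only [sum_option_three, adjMatrix_self, adjMatrix_symm G _ none, zero_mul, mul_zero,
    add_zero, sum_const_zero, hterm]

lemma edgeSum_option : edgeSum G = edgeSum (G.comap some) + ∑ i, 𝐀[G] none (some i) := by
  have h := sum_adjMatrix_option G fun _ _ => 1
  simp only [mul_one, ← sum_mul, ← adjMatrix_comap_some] at h
  rw [edgeSum, h, edgeSum]
  ring

lemma triangleSum_option :
    triangleSum G = triangleSum (G.comap some) + 1 / 2 * ∑ i, ∑ j,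
      𝐀[G] (some i) (some j) * (𝐀[G] none (some i) * 𝐀[G] none (some j)) := by
  have h := sum_adjMatrix_triangle_option G fun _ _ _ => 1
  simp only [mul_one, ← sum_mul, ← adjMatrix_comap_some G] at h
  rw [triangleSum, h, triangleSum]
  simp only [adjMatrix_comap_some]
  ring

lemma fourCliqueSum_option :
    fourCliqueSum G = fourCliqueSum (G.comap some) + 1 / 6 * ∑ i, ∑ j, ∑ k,
      𝐀[G] (some i) (some j) * 𝐀[G] (some i) (some k) * 𝐀[G] (some j) (some k) *
        (𝐀[G] none (some i) * 𝐀[G] none (some j) * 𝐀[G] none (some k)) := by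
  have hterm : ∀ i j k a b c : ℚ, a * b * c * (i * j * k) + a * i * j * (b * c * k)
      + i * a * j * (b * k * c) + i * j * a * (k * b * c) = 4 * (i * j * k * (a * b * c)) := by
    intros; ring
  rw [fourCliqueSum, sum_option_four (by simp) (by simp) (by simp) (by simp) (by simp) (by simp)]
  simp only [adjMatrix_symm G _ none, hterm, ← mul_sum]
  simp only [fourCliqueSum, adjMatrix_comap_some]
  ring

variable [DecidableEq α]

lemma inducedFourCycleSum_option :
    inducedFourCycleSum G = inducedFourCycleSum (G.comap some) + 1 / 2 * ∑ i, ∑ j, ∑ k,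
      𝐀[Gᶜ] none (some i) * 𝐀[Gᶜ] (some j) (some k) *
        (𝐀[G] none (some j) * 𝐀[G] none (some k) *
          (𝐀[G] (some i) (some j) * 𝐀[G] (some i) (some k))) := by
  set T : α → α → α → ℚ := fun i j k =>
    𝐀[Gᶜ] none (some i) * 𝐀[Gᶜ] (some j) (some k) *
      (𝐀[G] none (some j) * 𝐀[G] none (some k) *
        (𝐀[G] (some i) (some j) * 𝐀[G] (some i) (some k))) with hT
  have hrot : ∑ i, ∑ j, ∑ k, T k i j = ∑ i, ∑ j, ∑ k, T i j k :=
    (sum_congr rfl fun i _ => sum_comm).trans sum_comm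
  rw [inducedFourCycleSum, sum_option_four (by simp) (by simp) (by simp) (by simp) (by simp)
    (by simp), mul_add]
  congr 1
  · simp only [inducedFourCycleSum, adjMatrix_comap_some, compl_adjMatrix_comap_some]
  · trans 1 / 8 * ∑ i, ∑ j, ∑ k, (2 * T i j k + 2 * T k i j)
    · refine congrArg _ (sum_congr rfl fun i _ => sum_congr rfl fun j _ =>
        sum_congr rfl fun k _ => ?_)
      simp only [hT, adjMatrix_symm G _ none, adjMatrix_symm Gᶜ _ none, adjMatrix_symm G (some k)]
      ring
    · simp only [sum_add_distrib, ← mul_sum, hrot]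
      ring

lemma sum_compl_adjMatrix_mul :
    ∑ i, ∑ j, ∑ k, 𝐀[Gᶜ] none (some i) * 𝐀[Gᶜ] (some j) (some k) *
        (𝐀[G] none (some j) * 𝐀[G] none (some k) *
          (𝐀[G] (some i) (some j) * 𝐀[G] (some i) (some k))) =
      ∑ i, ∑ j, ∑ k, 𝐀[G] (some i) (some j) * 𝐀[G] (some i) (some k) *
          ((1 - 𝐀[G] none (some i)) * 𝐀[G] none (some j) * 𝐀[G] none (some k) *
            (1 - 𝐀[G] (some j) (some k)))
      - ∑ i, ∑ j, 𝐀[G] (some i) (some j) * ((1 - 𝐀[G] none (some i)) * 𝐀[G] none (some j)) := by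
  have hdiag : ∀ i j k, (if j = k then 1 else 0) *
        (𝐀[G] none (some j) * 𝐀[G] none (some k) *
          (𝐀[G] (some i) (some j) * 𝐀[G] (some i) (some k))) =
      if j = k then 𝐀[G] none (some j) * 𝐀[G] (some i) (some j) else 0 := by
    intro i j k
    split_ifs with hjk
    · rw [hjk, one_mul, adjMatrix_mul_self, adjMatrix_mul_self]
    · rw [zero_mul]
  rw [← sum_sub_distrib]
  refine sum_congr rfl fun i _ => ?_
  rw [← sum_sub_distrib]
  refine sum_congr rfl fun j _ => ?_
  have hsum := sum_congr (s₁ := univ) rfl fun k _ => hdiag i j k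
  rw [sum_ite_eq, if_pos (mem_univ _)] at hsum
  simp only [adjMatrix_compl, Option.some_inj, reduceCtorEq, if_false]
  rw [mul_left_comm, mul_comm (𝐀[G] (some i) (some j)), ← hsum, mul_sum, ← sum_sub_distrib]
  exact sum_congr rfl fun k _ => by ring

end VertexDeletion

section ColourNone

variable {α : Type*} (G : SimpleGraph (Option α)) [DecidableRel G.Adj]
  (r : Option α → Finset ℕ) (c : ℕ)

/-- The restraint that remains on the vertices other than `none` once `none` has received the
colour `c`: the neighbours of `none` may no longer use `c`. -/
def colourNone (i : α) : Finset ℕ :=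
  if G.Adj none (some i) then insert c (r (some i)) else r (some i)

/-- The indicator of the colour `c` being forbidden at `v`. -/
def forbids {V : Type*} (r : V → Finset ℕ) (c : ℕ) (v : V) : ℚ := if c ∈ r v then 1 else 0

lemma card_colourNone (i : α) : (#(colourNone G r c i) : ℚ) =
    #(r (some i)) + 𝐀[G] none (some i) * (1 - forbids r c (some i)) := by
  by_cases ha : G.Adj none (some i) <;> by_cases hc : c ∈ r (some i) <;>
    simp [colourNone, forbids, SimpleGraph.adjMatrix_apply, ha, hc]

lemma card_inter_colourNone (i j : α) :
    (#(colourNone G r c i ∩ colourNone G r c j) : ℚ) = #(r (some i) ∩ r (some j))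
      + 𝐀[G] none (some i) * 𝐀[G] none (some j)
      + (𝐀[G] none (some j) * (1 - 𝐀[G] none (some i)) * forbids r c (some i)
        + 𝐀[G] none (some i) * (1 - 𝐀[G] none (some j)) * forbids r c (some j))
      - (𝐀[G] none (some i) + 𝐀[G] none (some j) - 𝐀[G] none (some i) * 𝐀[G] none (some j))
        * (forbids r c (some i) * forbids r c (some j)) := by
  by_cases hi : G.Adj none (some i) <;> by_cases hj : G.Adj none (some j) <;>
    by_cases hci : c ∈ r (some i) <;> by_cases hcj : c ∈ r (some j) <;>
    simp [colourNone, forbids, SimpleGraph.adjMatrix_apply, hi, hj, hci, hcj]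

variable {G r c}

lemma notMem_colourNone {i : α} {d : ℕ} :
    d ∉ colourNone G r c i ↔ d ∉ r (some i) ∧ (G.Adj none (some i) → d ≠ c) := by
  by_cases ha : G.Adj none (some i) <;> simp [colourNone, ha, and_comm]

lemma forbids_eq_zero {V : Type*} {r : V → Finset ℕ} {v : V} (hc : c ∉ r v) : forbids r c v = 0 :=
  if_neg hc

variable (G)

lemma card_colourNone_of_notMem {i : α} (hc : ∀ v, c ∉ r v) :
    (#(colourNone G r c i) : ℚ) = #(r (some i)) + 𝐀[G] none (some i) := by
  rw [card_colourNone, forbids_eq_zero (hc _), sub_zero, mul_one]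

lemma card_inter_colourNone_of_notMem {i j : α} (hc : ∀ v, c ∉ r v) :
    (#(colourNone G r c i ∩ colourNone G r c j) : ℚ) = #(r (some i) ∩ r (some j))
      + 𝐀[G] none (some i) * 𝐀[G] none (some j) := by
  simp only [card_inter_colourNone, forbids_eq_zero (hc _), mul_zero, add_zero, sub_zero]

lemma card_inter_inter_colourNone_of_notMem {i j k : α} (hc : ∀ v, c ∉ r v) :
    (#(colourNone G r c i ∩ colourNone G r c j ∩ colourNone G r c k) : ℚ) =
      #(r (some i) ∩ r (some j) ∩ r (some k))
        + 𝐀[G] none (some i) * 𝐀[G] none (some j) * 𝐀[G] none (some k) := by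
  by_cases hi : G.Adj none (some i) <;> by_cases hj : G.Adj none (some j) <;>
    by_cases hk : G.Adj none (some k) <;>
    simp [colourNone, SimpleGraph.adjMatrix_apply, hi, hj, hk, hc]

lemma cumulantThree_option_vertex_term {i : α} (hc : ∀ v, c ∉ r v) :
    1 / 3 * 𝐀[G] none (some i)
        + 1 / 2 * (𝐀[G] none (some i) * (edgeWeight r none (some i) + edgeWeight r (some i) none))
        - 1 / 2 * (𝐀[G] none (some i) * cherryWeight r (some i) none none) =
      1 / 3 * ((#(colourNone G r c i) : ℚ) ^ 3 - #(r (some i)) ^ 3)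
        - #(r none) * (𝐀[G] none (some i) * (#(r (some i)) - #(r none ∩ r (some i))))
        - 𝐀[G] none (some i) * (#(r (some i)) + 1 / 2) *
          (#(r (some i)) - #(r none ∩ r (some i))) := by
  have hdup : r none ∩ r (some i) ∩ r none = r none ∩ r (some i) := by
    rw [inter_right_comm, inter_self]
  simp only [edgeWeight, cherryWeight, card_colourNone_of_notMem G hc, hdup, inter_self,
    inter_comm (r (some i)) (r none)]
  linear_combination -(#(r (some i)) + (1 + 𝐀[G] none (some i)) / 3) *
    adjMatrix_mul_self G none (some i)

end ColourNone

section ColourSums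

variable {α : Type*} [Fintype α] {G : SimpleGraph (Option α)} [DecidableRel G.Adj]
  {r : Option α → Finset ℕ} {c f : ℕ}

lemma cumulantOne_sub_cumulantOne (hf : ∀ v, f ∉ r v) :
    cumulantOne (G.comap some) (colourNone G r f) - cumulantOne (G.comap some) (colourNone G r c) =
      ∑ i, 𝐀[G] none (some i) * forbids r c (some i) := by
  simp only [cumulantOne, card_colourNone_of_notMem G hf, card_colourNone]
  rw [add_sub_add_left_eq_sub, ← sum_sub_distrib]
  exact sum_congr rfl fun i _ => by ring

lemma cumulantTwo_sub_cumulantTwo (hf : ∀ v, f ∉ r v) :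
    cumulantTwo (G.comap some) (colourNone G r f) - cumulantTwo (G.comap some) (colourNone G r c) =
      ∑ i, 𝐀[G] none (some i) * (#(r (some i)) + 1 / 2) * forbids r c (some i)
      + 1 / 2 * ∑ i, ∑ j, 𝐀[G] (some i) (some j) *
        ((𝐀[G] none (some i) + 𝐀[G] none (some j) - 𝐀[G] none (some i) * 𝐀[G] none (some j))
          * (forbids r c (some i) * forbids r c (some j))
        - (𝐀[G] none (some j) * (1 - 𝐀[G] none (some i)) * forbids r c (some i)
          + 𝐀[G] none (some i) * (1 - 𝐀[G] none (some j)) * forbids r c (some j))) := by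
  have hsq : ∀ i, (#(colourNone G r f i) : ℚ) ^ 2 - (#(colourNone G r c i) : ℚ) ^ 2 =
      2 * (𝐀[G] none (some i) * (#(r (some i)) + 1 / 2) * forbids r c (some i)) := by
    intro i
    rw [card_colourNone_of_notMem G hf, card_colourNone]
    have ha := adjMatrix_mul_self G none (some i)
    have hχ : forbids r c (some i) * forbids r c (some i) = forbids r c (some i) := by
      simp [forbids]
    linear_combination (2 * forbids r c (some i) - forbids r c (some i) ^ 2) * ha
      - 𝐀[G] none (some i) * hχ
  have hsum := sum_congr (s₁ := univ) rfl fun i _ => hsq i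
  rw [sum_sub_distrib, ← mul_sum] at hsum
  simp only [cumulantTwo, adjMatrix_comap_some, card_inter_colourNone_of_notMem G hf,
    card_inter_colourNone]
  rw [add_sub_add_comm, add_sub_add_left_eq_sub, ← mul_sub, ← mul_sub, hsum, ← sum_sub_distrib]
  simp only [← sum_sub_distrib]
  congr 1
  · ring
  · exact congrArg _ (sum_congr rfl fun i _ => sum_congr rfl fun j _ => by ring)

lemma sum_indicator_sdiff {A C : Finset ℕ} (R : Finset ℕ) (hA : A ⊆ C) :
    ∑ c ∈ C \ R, (if c ∈ A then 1 else 0 : ℚ) = #A - #(R ∩ A) := by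
  have hfilter : {c ∈ C \ R | c ∈ A} = A \ R := by
    ext c
    simp only [mem_filter, mem_sdiff]
    exact ⟨fun h => ⟨h.2, h.1.2⟩, fun h => ⟨⟨hA h.1, h.2⟩, h.1⟩⟩
  rw [sum_boole, hfilter, eq_sub_iff_add_eq, inter_comm]
  exact_mod_cast card_sdiff_add_card_inter A R

variable {V : Type*} {s : V → Finset ℕ} {C : Finset ℕ}

lemma sum_forbids_sdiff {u v : V} (hv : s v ⊆ C) :
    ∑ c ∈ C \ s u, forbids s c v = #(s v) - #(s u ∩ s v) :=
  sum_indicator_sdiff _ hv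

lemma sum_forbids_mul_forbids_sdiff {u v w : V} (hv : s v ⊆ C) :
    ∑ c ∈ C \ s u, forbids s c v * forbids s c w = #(s v ∩ s w) - #(s u ∩ s v ∩ s w) := by
  rw [inter_assoc (s u), ← sum_indicator_sdiff _ (inter_subset_left.trans hv)]
  simp only [forbids, mem_inter, ← ite_and, mul_ite, mul_one, mul_zero]
  exact sum_congr rfl fun c _ => if_congr and_comm rfl rfl

lemma sum_cumulantOne_sub_cumulantOne (hC : ∀ v, r v ⊆ C) (hf : ∀ v, f ∉ r v) :
    ∑ c ∈ C \ r none, (cumulantOne (G.comap some) (colourNone G r f)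
        - cumulantOne (G.comap some) (colourNone G r c)) =
      ∑ i, 𝐀[G] none (some i) * (#(r (some i)) - #(r none ∩ r (some i))) := by
  simp only [cumulantOne_sub_cumulantOne hf]
  rw [sum_comm]
  simp only [← mul_sum, sum_forbids_sdiff (hC _)]

lemma sum_cumulantOne_sub_cumulantOne_sq (hC : ∀ v, r v ⊆ C) (hf : ∀ v, f ∉ r v) :
    ∑ c ∈ C \ r none, (cumulantOne (G.comap some) (colourNone G r f)
        - cumulantOne (G.comap some) (colourNone G r c)) ^ 2 =
      ∑ i, ∑ j, 𝐀[G] none (some i) * 𝐀[G] none (some j) *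
        (#(r (some i) ∩ r (some j)) - #(r none ∩ r (some i) ∩ r (some j))) := by
  simp only [cumulantOne_sub_cumulantOne hf, sq, sum_mul_sum, mul_mul_mul_comm _ (forbids _ _ _)]
  rw [sum_comm]
  refine sum_congr rfl fun i _ => ?_
  rw [sum_comm]
  simp only [← mul_sum, sum_forbids_mul_forbids_sdiff (hC _)]

lemma sum_cumulantTwo_sub_cumulantTwo (hC : ∀ v, r v ⊆ C) (hf : ∀ v, f ∉ r v) :
    ∑ c ∈ C \ r none, (cumulantTwo (G.comap some) (colourNone G r f)
        - cumulantTwo (G.comap some) (colourNone G r c)) =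
      ∑ i, 𝐀[G] none (some i) * (#(r (some i)) + 1 / 2) * (#(r (some i)) - #(r none ∩ r (some i)))
      + 1 / 2 * ∑ i, ∑ j, 𝐀[G] (some i) (some j) *
        ((𝐀[G] none (some i) + 𝐀[G] none (some j) - 𝐀[G] none (some i) * 𝐀[G] none (some j))
          * (#(r (some i) ∩ r (some j)) - #(r none ∩ r (some i) ∩ r (some j)))
        - (𝐀[G] none (some j) * (1 - 𝐀[G] none (some i)) * (#(r (some i)) - #(r none ∩ r (some i)))
          + 𝐀[G] none (some i) * (1 - 𝐀[G] none (some j)) *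
            (#(r (some j)) - #(r none ∩ r (some j))))) := by
  simp only [cumulantTwo_sub_cumulantTwo hf, sum_add_distrib, ← mul_sum]
  congr 1
  · rw [sum_comm]
    simp only [← mul_sum, sum_forbids_sdiff (hC _)]
  · rw [sum_comm]
    refine congrArg _ (sum_congr rfl fun i _ => ?_)
    rw [sum_comm]
    simp only [← mul_sum, sum_sub_distrib, sum_add_distrib, sum_forbids_sdiff (hC _),
      sum_forbids_mul_forbids_sdiff (hC _)]

lemma cumulantOne_option (hf : ∀ v, f ∉ r v) :
    cumulantOne G r = cumulantOne (G.comap some) (colourNone G r f) + #(r none) := by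
  simp only [cumulantOne, edgeSum_option, Fintype.sum_option, card_colourNone_of_notMem G hf,
    sum_add_distrib]
  ring

lemma cumulantTwo_option (hC : ∀ v, r v ⊆ C) (hf : ∀ v, f ∉ r v) :
    cumulantTwo G r = cumulantTwo (G.comap some) (colourNone G r f) + (#(r none) : ℚ) ^ 2 / 2
      - ∑ c ∈ C \ r none, (cumulantOne (G.comap some) (colourNone G r f)
        - cumulantOne (G.comap some) (colourNone G r c)) := by
  have hsq : ∀ i, (#(colourNone G r f i) : ℚ) ^ 2 = #(r (some i)) ^ 2
      + (𝐀[G] none (some i) + 2 * (𝐀[G] none (some i) * #(r (some i)))) := by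
    intro i
    rw [card_colourNone_of_notMem G hf]
    linear_combination adjMatrix_mul_self G none (some i)
  rw [sum_cumulantOne_sub_cumulantOne hC hf]
  simp only [cumulantTwo, edgeSum_option G, triangleSum_option G, hsq,
    card_inter_colourNone_of_notMem G hf, adjMatrix_symm G _ none, adjMatrix_comap_some,
    Fintype.sum_option, adjMatrix_self, inter_comm _ (r none), mul_add, mul_sub, sum_add_distrib,
    sum_sub_distrib, ← mul_sum]
  ring

lemma cumulantThree_option_pair_sum (hf : ∀ v, f ∉ r v) :
    ∑ i, ∑ j, (𝐀[G] (some i) (some j) * (𝐀[G] none (some i) * 𝐀[G] none (some j))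
        + 1 / 2 * (𝐀[G] (some i) (some j) * ((1 - 𝐀[G] none (some i)) * 𝐀[G] none (some j)))
        - 1 / 2 * (𝐀[G] none (some i) * 𝐀[G] none (some j) * cherryWeight r none (some i) (some j)
          + 𝐀[G] (some i) (some j) * 𝐀[G] none (some i) *
            (cherryWeight r (some i) none (some j) + cherryWeight r (some i) (some j) none))
        + 𝐀[G] (some i) (some j) * (𝐀[G] none (some i) * 𝐀[G] none (some j)) *
          (triangleWeight r none (some i) (some j) + triangleWeight r (some i) none (some j)
            + triangleWeight r (some i) (some j) none)) =
      ∑ i, ∑ j, (1 / 2 * (𝐀[G] (some i) (some j) *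
          (edgeWeight (colourNone G r f) i j - edgeWeight r (some i) (some j)))
        - 1 / 2 * (𝐀[G] (some i) (some j) *
          ((𝐀[G] none (some i) + 𝐀[G] none (some j) - 𝐀[G] none (some i) * 𝐀[G] none (some j))
            * (#(r (some i) ∩ r (some j)) - #(r none ∩ r (some i) ∩ r (some j)))
          - (𝐀[G] none (some j) * (1 - 𝐀[G] none (some i)) *
              (#(r (some i)) - #(r none ∩ r (some i)))
            + 𝐀[G] none (some i) * (1 - 𝐀[G] none (some j)) *
              (#(r (some j)) - #(r none ∩ r (some j))))))
        - 1 / 2 * (𝐀[G] none (some i) * 𝐀[G] none (some j) *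
          (#(r (some i) ∩ r (some j)) - #(r none ∩ r (some i) ∩ r (some j))))) := by
  refine sum_sum_congr_symm fun i j => ?_
  simp only [edgeWeight, cherryWeight, triangleWeight, card_colourNone_of_notMem G hf,
    card_inter_colourNone_of_notMem G hf, adjMatrix_symm G (some j) (some i),
    inter_comm (r (some j)) (r (some i)), inter_comm _ (r none), ← inter_assoc,
    inter_right_comm (r none) (r (some j)) (r (some i))]
  linear_combination
    -(𝐀[G] (some i) (some j) * 𝐀[G] none (some j)) * adjMatrix_mul_self G none (some i)
    - (𝐀[G] (some i) (some j) * 𝐀[G] none (some i)) * adjMatrix_mul_self G none (some j)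

variable [DecidableEq α]

lemma cumulantThree_option_eq_add :
    cumulantThree G r = cumulantThree (G.comap some) (r ∘ some) + (#(r none) : ℚ) ^ 3 / 3
      + (∑ i, (1 / 3 * 𝐀[G] none (some i)
          + 1 / 2 * (𝐀[G] none (some i) * (edgeWeight r none (some i) + edgeWeight r (some i) none))
          - 1 / 2 * (𝐀[G] none (some i) * cherryWeight r (some i) none none)))
      + (∑ i, ∑ j, (𝐀[G] (some i) (some j) * (𝐀[G] none (some i) * 𝐀[G] none (some j))
          + 1 / 2 * (𝐀[G] (some i) (some j) * ((1 - 𝐀[G] none (some i)) * 𝐀[G] none (some j)))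
          - 1 / 2 * (𝐀[G] none (some i) * 𝐀[G] none (some j) * cherryWeight r none (some i) (some j)
            + 𝐀[G] (some i) (some j) * 𝐀[G] none (some i) *
              (cherryWeight r (some i) none (some j) + cherryWeight r (some i) (some j) none))
          + 𝐀[G] (some i) (some j) * (𝐀[G] none (some i) * 𝐀[G] none (some j)) *
            (triangleWeight r none (some i) (some j) + triangleWeight r (some i) none (some j)
              + triangleWeight r (some i) (some j) none)))
      + ∑ i, ∑ j, ∑ k,
          (1 / 3 * (𝐀[G] (some i) (some j) * 𝐀[G] (some i) (some k) * 𝐀[G] (some j) (some k) *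
            (𝐀[G] none (some i) * 𝐀[G] none (some j) * 𝐀[G] none (some k)))
          - 1 / 2 * (𝐀[G] (some i) (some j) * 𝐀[G] (some i) (some k) *
            ((1 - 𝐀[G] none (some i)) * 𝐀[G] none (some j) * 𝐀[G] none (some k) *
              (1 - 𝐀[G] (some j) (some k))))) := by
  rw [cumulantThree, sum_adjMatrix_option, sum_adjMatrix_cherry_option,
    sum_adjMatrix_triangle_option, Fintype.sum_option, edgeSum_option, triangleSum_option,
    fourCliqueSum_option, inducedFourCycleSum_option, sum_compl_adjMatrix_mul]
  simp only [cumulantThree, Function.comp_apply, adjMatrix_comap_some, edgeWeight_comp,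
    cherryWeight_comp, triangleWeight_comp, sum_add_distrib, sum_sub_distrib, ← mul_sum]
  ring

lemma cumulantThree_colourNone_eq_add (hf : ∀ v, f ∉ r v) :
    cumulantThree (G.comap some) (colourNone G r f) = cumulantThree (G.comap some) (r ∘ some)
      + (∑ i, 1 / 3 * ((#(colourNone G r f i) : ℚ) ^ 3 - #(r (some i)) ^ 3))
      + (∑ i, ∑ j, 1 / 2 * (𝐀[G] (some i) (some j) *
          (edgeWeight (colourNone G r f) i j - edgeWeight r (some i) (some j))))
      + ∑ i, ∑ j, ∑ k,
          (1 / 3 * (𝐀[G] (some i) (some j) * 𝐀[G] (some i) (some k) * 𝐀[G] (some j) (some k) *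
            (𝐀[G] none (some i) * 𝐀[G] none (some j) * 𝐀[G] none (some k)))
          - 1 / 2 * (𝐀[G] (some i) (some j) * 𝐀[G] (some i) (some k) *
            ((1 - 𝐀[G] none (some i)) * 𝐀[G] none (some j) * 𝐀[G] none (some k) *
              (1 - 𝐀[G] (some j) (some k))))) := by
  have htriple : ∀ i j k,
      1 / 3 * (𝐀[G] (some i) (some j) * 𝐀[G] (some i) (some k) * 𝐀[G] (some j) (some k) *
        (𝐀[G] none (some i) * 𝐀[G] none (some j) * 𝐀[G] none (some k)))
      - 1 / 2 * (𝐀[G] (some i) (some j) * 𝐀[G] (some i) (some k) *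
        ((1 - 𝐀[G] none (some i)) * 𝐀[G] none (some j) * 𝐀[G] none (some k) *
          (1 - 𝐀[G] (some j) (some k)))) =
      𝐀[G] (some i) (some j) * 𝐀[G] (some i) (some k) * 𝐀[G] (some j) (some k) *
        triangleWeight (colourNone G r f) i j k
      - 𝐀[G] (some i) (some j) * 𝐀[G] (some i) (some k) * 𝐀[G] (some j) (some k) *
        triangleWeight r (some i) (some j) (some k)
      - 1 / 2 * (𝐀[G] (some i) (some j) * 𝐀[G] (some i) (some k) *
        cherryWeight (colourNone G r f) i j k)
      + 1 / 2 * (𝐀[G] (some i) (some j) * 𝐀[G] (some i) (some k) *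
        cherryWeight r (some i) (some j) (some k)) := by
    intro i j k
    simp only [cherryWeight, triangleWeight, card_inter_colourNone_of_notMem G hf,
      card_inter_inter_colourNone_of_notMem G hf]
    ring
  simp only [htriple, cumulantThree, Function.comp_apply, adjMatrix_comap_some, edgeWeight_comp,
    cherryWeight_comp, triangleWeight_comp, sum_add_distrib, sum_sub_distrib, ← mul_sum,
    mul_sub (𝐀[G] (some _) (some _))]
  ring

lemma cumulantThree_option (hC : ∀ v, r v ⊆ C) (hf : ∀ v, f ∉ r v) :
    cumulantThree G r = cumulantThree (G.comap some) (colourNone G r f)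
      + (#(r none) : ℚ) ^ 3 / 3
      - #(r none) * (∑ c ∈ C \ r none, (cumulantOne (G.comap some) (colourNone G r f)
        - cumulantOne (G.comap some) (colourNone G r c)))
      - (∑ c ∈ C \ r none, (cumulantTwo (G.comap some) (colourNone G r f)
        - cumulantTwo (G.comap some) (colourNone G r c)))
      - 1 / 2 * ∑ c ∈ C \ r none, (cumulantOne (G.comap some) (colourNone G r f)
        - cumulantOne (G.comap some) (colourNone G r c)) ^ 2 := by
  rw [cumulantThree_option_eq_add, cumulantThree_colourNone_eq_add hf,
    sum_cumulantOne_sub_cumulantOne hC hf, sum_cumulantTwo_sub_cumulantTwo hC hf,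
    sum_cumulantOne_sub_cumulantOne_sq hC hf, cumulantThree_option_pair_sum hf,
    sum_congr rfl fun _ _ => cumulantThree_option_vertex_term G hf]
  simp only [sum_sub_distrib, ← mul_sum]
  ring

end ColourSums

section Recursion

variable {α : Type*} [Fintype α] [DecidableEq α] {G : SimpleGraph (Option α)} [DecidableRel G.Adj]
  {r : Option α → Finset ℕ} {M x : ℕ}

lemma mem_permittedColourings {V : Type*} [Fintype V] [DecidableEq V] {H : SimpleGraph V}
    [DecidableRel H.Adj] {s : V → Finset ℕ} {col : V → ℕ} :
    col ∈ permittedColourings H s x ↔ (∀ v, col v ∈ Icc 1 x) ∧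
      (∀ u v, H.Adj u v → col u ≠ col v) ∧ ∀ v, col v ∉ s v := by
  rw [permittedColourings, mem_filter, Fintype.mem_piFinset]

lemma mem_permittedColourings_option {col : Option α → ℕ} :
    col ∈ permittedColourings G r x ↔ col none ∈ Icc 1 x \ r none ∧
      col ∘ some ∈ permittedColourings (G.comap some) (colourNone G r (col none)) x := by
  simp only [mem_permittedColourings, Option.forall, mem_sdiff, notMem_colourNone,
    SimpleGraph.comap_adj, Function.comp_apply, G.irrefl, forall_and]
  constructor
  · tauto
  · rintro ⟨⟨hx, hr⟩, hxs, hprop, hrs, hnone⟩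
    exact ⟨⟨hx, hxs⟩, ⟨⟨by simp, fun i h => hnone i h.symm⟩,
      fun i h => (hnone i h).symm, hprop⟩, hr, hrs⟩

lemma restrainedCount_option : restrainedCount G r x =
    ∑ c ∈ Icc 1 x \ r none, restrainedCount (G.comap some) (colourNone G r c) x := by
  rw [restrainedCount, card_eq_sum_card_fiberwise (f := fun col => col none)
    fun col hcol => (mem_permittedColourings_option.mp hcol).1]
  refine sum_congr rfl fun c hc => ?_
  have hnone : ∀ col : Option α → ℕ, col none = c → (fun v => v.elim c (col ∘ some)) = col :=
    fun col hcol => funext fun v => by cases v <;> simp [hcol]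
  refine card_nbij' (· ∘ some) (fun col v => v.elim c col) ?_ ?_ ?_ fun _ _ => rfl
  · intro col hcol
    obtain ⟨hmem, rfl⟩ := mem_filter.mp hcol
    exact (mem_permittedColourings_option.mp hmem).2
  · exact fun col hcol => mem_filter.mpr ⟨mem_permittedColourings_option.mpr ⟨hc, hcol⟩, rfl⟩
  · exact fun col hcol => hnone col (mem_filter.mp hcol).2

lemma restrainedCount_comp_equiv {V W : Type*} [Fintype V] [DecidableEq V] [Fintype W]
    [DecidableEq W] (e : V ≃ W) (H : SimpleGraph W) [DecidableRel H.Adj] (s : W → Finset ℕ) :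
    restrainedCount (H.comap e) (s ∘ e) x = restrainedCount H s x := by
  refine card_equiv (e.arrowCongr (Equiv.refl ℕ)) fun col => ?_
  simp only [mem_permittedColourings, Equiv.arrowCongr_apply, Equiv.coe_refl, Function.comp_apply,
    id_eq, SimpleGraph.comap_adj, e.surjective.forall, e.symm_apply_apply]

lemma restrainedCount_colourNone_congr {c d : ℕ} (hc : ∀ v, c ∉ r v) (hd : ∀ v, d ∉ r v)
    (hcx : c ∈ Icc 1 x) (hdx : d ∈ Icc 1 x) :
    restrainedCount (G.comap some) (colourNone G r c) x =
      restrainedCount (G.comap some) (colourNone G r d) x := by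
  refine card_equiv ((Equiv.refl α).arrowCongr (Equiv.swap c d)) fun col => ?_
  simp only [mem_permittedColourings, Equiv.arrowCongr_apply, Equiv.coe_refl, Function.comp_apply,
    Equiv.refl_symm, id_eq, notMem_colourNone, (Equiv.swap c d).injective.ne_iff]
  have hswap_mem : ∀ {S : Finset ℕ}, (c ∈ S ↔ d ∈ S) → ∀ e, Equiv.swap c d e ∈ S ↔ e ∈ S := by
    intro S h e
    rw [Equiv.swap_apply_def]
    split_ifs with hec hed <;> simp only [*]
  have hswap_eq : ∀ e, Equiv.swap c d e = d ↔ e = c := fun e => by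
    rw [← Equiv.apply_eq_iff_eq (Equiv.swap c d) (x := e), Equiv.swap_apply_left]
  simp only [hswap_mem (iff_of_true hcx hdx), hswap_mem (iff_of_false (hc _) (hd _)), ne_eq,
    hswap_eq]

end Recursion

section Expansion

/-- `∑ₖ (-1)ᵏ bₖ xⁿ⁻ᵏ`: the coefficients of an alternating polynomial of degree `n`, listed from
the leading one downwards. -/
def alternatingSum (n : ℕ) (b : ℕ → ℤ) (x : ℤ) : ℤ :=
  ∑ k ∈ range (n + 1), (-1) ^ k * b k * x ^ (n - k)

/-- The coefficient sequence, in the sense of `alternatingSum`, of `(x - M) B(x) + S(x)`, where `b`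
and `s` are the coefficient sequences of `B` and `S`. -/
def stepCoeff (M : ℤ) (b s : ℕ → ℤ) : ℕ → ℤ
  | 0 => b 0
  | k + 1 => b (k + 1) + (M * b k - s k)

lemma alternatingSum_stepCoeff {n : ℕ} {b : ℕ → ℤ} (hb : b (n + 1) = 0) (M : ℤ) (s : ℕ → ℤ)
    (x : ℤ) : alternatingSum (n + 1) (stepCoeff M b s) x =
      (x - M) * alternatingSum n b x + alternatingSum n s x := by
  have hshift : x * alternatingSum n b x =
      ∑ k ∈ range (n + 1), (-1) ^ (k + 1) * b (k + 1) * x ^ (n - k) + b 0 * x ^ (n + 1) := by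
    have hdrop : x * alternatingSum n b x = alternatingSum (n + 1) b x := by
      rw [alternatingSum, alternatingSum, sum_range_succ _ (n + 1), hb, mul_zero, zero_mul,
        add_zero, mul_sum]
      refine sum_congr rfl fun k hk => ?_
      rw [Nat.succ_sub (mem_range_succ_iff.mp hk), pow_succ]
      ring
    rw [hdrop, alternatingSum, sum_range_succ']
    simp
  rw [sub_mul, hshift, alternatingSum, sum_range_succ', alternatingSum, alternatingSum, mul_sum,
    add_sub_right_comm, add_right_comm, ← sum_sub_distrib, ← sum_add_distrib]
  congr 1
  · refine sum_congr rfl fun k _ => ?_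
    rw [stepCoeff, Nat.succ_sub_succ]
    ring
  · simp [stepCoeff]

lemma alternatingSum_sum {ι : Type*} (S : Finset ι) (n : ℕ) (b : ι → ℕ → ℤ) (x : ℤ) :
    alternatingSum n (fun k => ∑ c ∈ S, b c k) x = ∑ c ∈ S, alternatingSum n (b c) x := by
  simp only [alternatingSum, mul_sum, sum_mul]
  exact sum_comm

/-- `b` lists, in the sense of `alternatingSum`, the coefficients of the polynomial that counts
the permitted `x`-colourings for all `x ≥ M`; it is padded with zeros. -/
structure IsExpansion {V : Type*} [Fintype V] [DecidableEq V] (G : SimpleGraph V)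
    [DecidableRel G.Adj] (r : V → Finset ℕ) (M : ℕ) (b : ℕ → ℤ) : Prop where
  eq_zero : ∀ k, Fintype.card V < k → b k = 0
  count_eq : ∀ x, M ≤ x → (restrainedCount G r x : ℤ) = alternatingSum (Fintype.card V) b x

variable {α : Type*} [Fintype α] [DecidableEq α] {G : SimpleGraph (Option α)} [DecidableRel G.Adj]
  {r : Option α → Finset ℕ} {M : ℕ}

lemma restrainedCount_option_of_le {x : ℕ} (hr : ∀ v, r v ⊆ Icc 1 M) (hx : M ≤ x) :
    (restrainedCount G r x : ℤ) =
      (x - M) * restrainedCount (G.comap some) (colourNone G r (M + 1)) x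
      + ∑ c ∈ Icc 1 M \ r none, restrainedCount (G.comap some) (colourNone G r c) x := by
  have hfresh : ∀ c ∈ Ioc M x, restrainedCount (G.comap some) (colourNone G r c) x =
      restrainedCount (G.comap some) (colourNone G r (M + 1)) x := by
    intro c hc
    rw [mem_Ioc] at hc
    refine restrainedCount_colourNone_congr ?_ ?_ ?_ ?_
    · exact fun v hv => by have := mem_Icc.mp (hr v hv); lia
    · exact fun v hv => by have := mem_Icc.mp (hr v hv); lia
    · rw [mem_Icc]; lia
    · rw [mem_Icc]; lia
  have hsplit : Icc 1 x \ r none = (Icc 1 M \ r none) ∪ Ioc M x := by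
    ext c
    have := @hr none c
    simp only [mem_sdiff, mem_union, mem_Icc, mem_Ioc] at this ⊢
    grind
  have hdisj : Disjoint (Icc 1 M \ r none) (Ioc M x) := by
    rw [disjoint_left]
    intro c hc hc'
    have := mem_Icc.mp (mem_sdiff.mp hc).1
    have := mem_Ioc.mp hc'
    lia
  rw [restrainedCount_option, hsplit, sum_union hdisj, sum_congr rfl hfresh, sum_const,
    Nat.card_Ioc, smul_eq_mul]
  push_cast [hx]
  ring

lemma IsExpansion.option {b : ℕ → ℤ} {b' : ℕ → ℕ → ℤ} (hr : ∀ v, r v ⊆ Icc 1 M)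
    (hb : IsExpansion (G.comap some) (colourNone G r (M + 1)) (M + 1) b)
    (hb' : ∀ c ∈ Icc 1 M \ r none, IsExpansion (G.comap some) (colourNone G r c) M (b' c)) :
    IsExpansion G r M (stepCoeff M b fun k => ∑ c ∈ Icc 1 M \ r none, b' c k) := by
  refine ⟨fun k hk => ?_, fun x hx => ?_⟩
  · rw [Fintype.card_option] at hk
    obtain ⟨k, rfl⟩ := Nat.exists_eq_succ_of_ne_zero (Nat.ne_zero_of_lt hk)
    have hk' : Fintype.card α < k := by lia
    rw [stepCoeff, hb.eq_zero _ (by lia), hb.eq_zero _ hk',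
      sum_eq_zero fun c hc => (hb' c hc).eq_zero _ hk']
    simp
  · have hfresh : ((x : ℤ) - M) * restrainedCount (G.comap some) (colourNone G r (M + 1)) x =
        (x - M) * alternatingSum (Fintype.card α) b x := by
      obtain rfl | hlt := hx.eq_or_lt
      · rw [sub_self, zero_mul, zero_mul]
      · rw [hb.count_eq x hlt]
    rw [Fintype.card_option, alternatingSum_stepCoeff (hb.eq_zero _ (Nat.lt_succ_self _)),
      alternatingSum_sum, restrainedCount_option_of_le hr hx, hfresh]
    push_cast
    rw [sum_congr rfl fun c hc => (hb' c hc).count_eq x hx]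

lemma IsExpansion.of_comp_equiv {V W : Type*} [Fintype V] [DecidableEq V] [Fintype W]
    [DecidableEq W] (e : V ≃ W) {H : SimpleGraph W} [DecidableRel H.Adj] {s : W → Finset ℕ}
    {M : ℕ} {b : ℕ → ℤ} (h : IsExpansion (H.comap e) (s ∘ e) M b) : IsExpansion H s M b where
  eq_zero := Fintype.card_congr e ▸ h.eq_zero
  count_eq x hx := restrainedCount_comp_equiv e H s ▸ Fintype.card_congr e ▸ h.count_eq x hx

end Expansion

section LeadingCoefficients

/-- `κ₁, κ₂, κ₃` are the first cumulants of the coefficient sequence `b`: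
`∑ₖ (-1)ᵏ bₖ tᵏ = exp (-κ₁ t - κ₂ t² - κ₃ t³ + O(t⁴))`. -/
structure HasCumulants (b : ℕ → ℤ) (κ₁ κ₂ κ₃ : ℚ) : Prop where
  coeff_zero : b 0 = 1
  coeff_one : (b 1 : ℚ) = κ₁
  coeff_two : (b 2 : ℚ) = κ₁ ^ 2 / 2 - κ₂
  coeff_three : (b 3 : ℚ) = κ₁ ^ 3 / 6 - κ₁ * κ₂ + κ₃

lemma HasCumulants.stepCoeff {ι : Type*} {S : Finset ι} {M w : ℕ} (hS : #S + w = M) {b : ℕ → ℤ}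
    {b' : ι → ℕ → ℤ} {κ₁ κ₂ κ₃ : ℚ} {κ₁' κ₂' κ₃' : ι → ℚ} (hb : HasCumulants b κ₁ κ₂ κ₃)
    (hb' : ∀ c ∈ S, HasCumulants (b' c) (κ₁' c) (κ₂' c) (κ₃' c)) :
    HasCumulants (stepCoeff M b fun k => ∑ c ∈ S, b' c k) (κ₁ + w)
      (κ₂ + (w : ℚ) ^ 2 / 2 - ∑ c ∈ S, (κ₁ - κ₁' c))
      (κ₃ + (w : ℚ) ^ 3 / 3 - w * ∑ c ∈ S, (κ₁ - κ₁' c) - ∑ c ∈ S, (κ₂ - κ₂' c)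
        - 1 / 2 * ∑ c ∈ S, (κ₁ - κ₁' c) ^ 2) := by
  have hM : (M : ℚ) = #S + w := by exact_mod_cast hS.symm
  have hzero : ∑ c ∈ S, (b' c 0 : ℚ) = #S := by
    rw [sum_congr rfl fun c hc => by rw [(hb' c hc).coeff_zero]]
    simp
  have hone : ∑ c ∈ S, (b' c 1 : ℚ) = #S * κ₁ - ∑ c ∈ S, (κ₁ - κ₁' c) := by
    rw [sum_congr rfl fun c hc => (hb' c hc).coeff_one, sum_sub_distrib, sum_const, nsmul_eq_mul]
    ring
  have htwo : ∑ c ∈ S, (b' c 2 : ℚ) = #S * (κ₁ ^ 2 / 2 - κ₂) - κ₁ * ∑ c ∈ S, (κ₁ - κ₁' c)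
      + 1 / 2 * ∑ c ∈ S, (κ₁ - κ₁' c) ^ 2 + ∑ c ∈ S, (κ₂ - κ₂' c) := by
    rw [sum_congr rfl fun c hc => (hb' c hc).coeff_two, ← nsmul_eq_mul, ← sum_const, mul_sum,
      mul_sum, ← sum_sub_distrib, ← sum_add_distrib, ← sum_add_distrib]
    exact sum_congr rfl fun c _ => by ring
  refine ⟨hb.coeff_zero, ?_, ?_, ?_⟩
  · simp only [RestrainedColouring.stepCoeff]
    push_cast
    rw [hb.coeff_one, hb.coeff_zero, hzero, hM]
    push_cast
    ring
  · simp only [RestrainedColouring.stepCoeff]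
    push_cast
    rw [hb.coeff_two, hb.coeff_one, hone, hM]
    ring
  · simp only [RestrainedColouring.stepCoeff]
    push_cast
    rw [hb.coeff_three, hb.coeff_two, htwo, hM]
    ring

section Equivalence

variable {V W : Type*} [Fintype V] [Fintype W] (e : V ≃ W) (H : SimpleGraph W) [DecidableRel H.Adj]
  (s : W → Finset ℕ)

lemma edgeSum_comp_equiv : edgeSum (H.comap e) = edgeSum H := by
  simp only [edgeSum, ← e.sum_comp]
  rfl

lemma triangleSum_comp_equiv : triangleSum (H.comap e) = triangleSum H := by
  simp only [triangleSum, ← e.sum_comp]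
  rfl

lemma fourCliqueSum_comp_equiv : fourCliqueSum (H.comap e) = fourCliqueSum H := by
  simp only [fourCliqueSum, ← e.sum_comp]
  rfl

lemma cumulantOne_comp_equiv : cumulantOne (H.comap e) (s ∘ e) = cumulantOne H s := by
  simp only [cumulantOne, edgeSum_comp_equiv, ← e.sum_comp]
  rfl

lemma cumulantTwo_comp_equiv : cumulantTwo (H.comap e) (s ∘ e) = cumulantTwo H s := by
  simp only [cumulantTwo, edgeSum_comp_equiv, triangleSum_comp_equiv, ← e.sum_comp]
  rfl

variable [DecidableEq V] [DecidableEq W]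

lemma inducedFourCycleSum_comp_equiv : inducedFourCycleSum (H.comap e) = inducedFourCycleSum H := by
  simp only [inducedFourCycleSum, ← e.sum_comp, adjMatrix_compl, e.apply_eq_iff_eq]
  rfl

lemma cumulantThree_comp_equiv : cumulantThree (H.comap e) (s ∘ e) = cumulantThree H s := by
  simp only [cumulantThree, edgeSum_comp_equiv, triangleSum_comp_equiv, fourCliqueSum_comp_equiv,
    inducedFourCycleSum_comp_equiv, ← e.sum_comp]
  rfl

end Equivalence

lemma IsExpansion.of_isEmpty {V : Type*} [Fintype V] [DecidableEq V] [IsEmpty V]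
    (G : SimpleGraph V) [DecidableRel G.Adj] (r : V → Finset ℕ) (M : ℕ) :
    IsExpansion G r M (Pi.single 0 1) where
  eq_zero k hk := Pi.single_eq_of_ne (Nat.ne_zero_of_lt hk) _
  count_eq x _ := by
    simp [alternatingSum, restrainedCount, permittedColourings]

lemma HasCumulants.of_isEmpty {V : Type*} [Fintype V] [DecidableEq V] [IsEmpty V]
    (G : SimpleGraph V) [DecidableRel G.Adj] (r : V → Finset ℕ) :
    HasCumulants (Pi.single 0 1) (cumulantOne G r) (cumulantTwo G r) (cumulantThree G r) := by
  constructor <;> simp [cumulantOne, cumulantTwo, cumulantThree, edgeSum, triangleSum,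
    fourCliqueSum, inducedFourCycleSum]

lemma colourNone_subset {α : Type*} {G : SimpleGraph (Option α)} [DecidableRel G.Adj]
    {r : Option α → Finset ℕ} {C : Finset ℕ} (hr : ∀ v, r v ⊆ C) {c : ℕ} (hc : c ∈ C) (i : α) :
    colourNone G r c i ⊆ C := by
  rw [colourNone]
  split_ifs
  · exact insert_subset hc (hr _)
  · exact hr _

theorem exists_isExpansion_hasCumulants {V : Type*} [Fintype V] [DecidableEq V]
    (G : SimpleGraph V) [DecidableRel G.Adj] {r : V → Finset ℕ} {M : ℕ}
    (hr : ∀ v, r v ⊆ Icc 1 M) :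
    ∃ b, IsExpansion G r M b ∧
      HasCumulants b (cumulantOne G r) (cumulantTwo G r) (cumulantThree G r) := by
  revert r M
  refine Fintype.induction_empty_option (P := fun V _ => ∀ [DecidableEq V] (G : SimpleGraph V)
    [DecidableRel G.Adj] {r : V → Finset ℕ} {M : ℕ}, (∀ v, r v ⊆ Icc 1 M) → ∃ b,
      IsExpansion G r M b ∧
        HasCumulants b (cumulantOne G r) (cumulantTwo G r) (cumulantThree G r)) ?_ ?_ ?_ V G
  · intro V W _ e ih _ G _ r M hr
    let := Fintype.ofEquiv W e.symm
    let := e.decidableEq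
    obtain ⟨b, hb, hκ⟩ := ih (G.comap e) fun v => hr (e v)
    rw [← cumulantOne_comp_equiv e, ← cumulantTwo_comp_equiv e, ← cumulantThree_comp_equiv e]
    exact ⟨b, hb.of_comp_equiv e, hκ⟩
  · intro _ G _ r M _
    exact ⟨_, .of_isEmpty G r M, .of_isEmpty G r⟩
  · intro α _ ih inst G _ r M hr
    classical
    obtain rfl : inst = Option.instDecidableEq := Subsingleton.elim _ _
    have hfresh : ∀ v, M + 1 ∉ r v := fun v hv => by have := mem_Icc.mp (hr v hv); lia
    have hcard : #(Icc 1 M \ r none) + #(r none) = M := by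
      rw [card_sdiff_add_card_eq_card (hr none), Nat.card_Icc, Nat.add_sub_cancel]
    obtain ⟨b, hb, hκ⟩ := ih (G.comap some) (colourNone_subset (G := G)
      (fun v => (hr v).trans (Icc_subset_Icc_right M.le_succ)) (right_mem_Icc.mpr M.succ_pos))
    choose! b' hb' hκ' using fun c (hc : c ∈ Icc 1 M \ r none) =>
      ih (G.comap some) (colourNone_subset (G := G) hr (sdiff_subset hc))
    refine ⟨_, hb.option hr hb', ?_⟩
    rw [cumulantOne_option hfresh, cumulantTwo_option hr hfresh, cumulantThree_option hr hfresh]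
    exact hκ.stepCoeff hcard hκ'

end LeadingCoefficients

section SubgraphCounts

variable {V W : Type*}

lemma card_embedding_range_eq (G : SimpleGraph V) (H : SimpleGraph W) {S : Set V}
    (e : G.induce S ≃g H) : Nat.card {f : H ↪g G // Set.range f = S} = Nat.card (H ≃g H) := by
  let ofIso : (H ≃g H) → {f : H ↪g G // Set.range f = S} := fun σ =>
    ⟨(SimpleGraph.Embedding.induce S).comp (σ.trans e.symm).toRelEmbedding, by
      exact ((σ.trans e.symm).surjective.range_comp ((↑) : S → V)).trans Subtype.range_coe⟩
  refine (Nat.card_congr (Equiv.ofBijective ofIso ⟨fun σ τ hστ => ?_, ?_⟩)).symm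
  · refine RelIso.ext fun w => e.symm.injective (Subtype.ext ?_)
    exact DFunLike.congr_fun (congrArg Subtype.val hστ) w
  · rintro ⟨f, rfl⟩
    refine ⟨f.isoInduceRange.trans e, Subtype.ext (RelEmbedding.ext fun w => ?_)⟩
    exact congrArg Subtype.val (e.symm_apply_apply (f.isoInduceRange w))

lemma card_embedding [Finite V] [Finite W] (G : SimpleGraph V) (H : SimpleGraph W) :
    Nat.card (H ↪g G) = inducedCount G H * Nat.card (H ≃g H) := by
  let image : (H ↪g G) → {S : Set V | Nonempty (G.induce S ≃g H)} := fun f =>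
    ⟨Set.range f, ⟨f.isoInduceRange.symm⟩⟩
  have hfibre : ∀ S, Nat.card {f // image f = S} = Nat.card (H ≃g H) := by
    rintro ⟨S, ⟨e⟩⟩
    simpa only [image, Subtype.mk.injEq] using card_embedding_range_eq G H e
  have := Fintype.ofFinite {S : Set V | Nonempty (G.induce S ≃g H)}
  have : Finite (H ↪g G) := Finite.of_injective _ DFunLike.coe_injective
  rw [Nat.card_congr (Equiv.sigmaFiberEquiv image).symm, Nat.card_sigma]
  simp only [hfibre, sum_const, smul_eq_mul, card_univ, inducedCount, ← Nat.card_coe_set_eq,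
    Nat.card_eq_fintype_card]

lemma subgraph_adj_iff_of_iso_top {G : SimpleGraph V} {G' : G.Subgraph}
    (e : (⊤ : SimpleGraph W) ≃g G'.coe) {x y : V} :
    G'.Adj x y ↔ x ∈ G'.verts ∧ y ∈ G'.verts ∧ x ≠ y := by
  refine ⟨fun h => ⟨h.fst_mem, h.snd_mem, h.ne⟩, fun ⟨hx, hy, hxy⟩ => ?_⟩
  have hadj : (⊤ : SimpleGraph W).Adj (e.symm ⟨x, hx⟩) (e.symm ⟨y, hy⟩) := by
    simpa [SimpleGraph.top_adj] using hxy
  exact e.symm.map_rel_iff.1 hadj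

lemma copyCount_top [Fintype V] (G : SimpleGraph V) :
    G.copyCount (⊤ : SimpleGraph W) = inducedCount G (⊤ : SimpleGraph W) := by
  classical
  rw [SimpleGraph.copyCount, inducedCount, ← Set.ncard_coe_finset]
  simp only [coe_filter, mem_univ, true_and]
  refine Set.ncard_congr (fun G' _ => G'.verts) ?_ ?_ ?_
  · rintro G' ⟨e⟩
    refine ⟨⟨e.symm.toEquiv, fun {x y} => ?_⟩⟩
    refine e.symm.map_rel_iff.trans ⟨fun h => h.adj_sub, fun h => ?_⟩
    exact (subgraph_adj_iff_of_iso_top e).2 ⟨x.2, y.2, G.ne_of_adj h⟩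
  · rintro G₁ G₂ ⟨e₁⟩ ⟨e₂⟩ hverts
    refine SimpleGraph.Subgraph.ext hverts ?_
    ext x y
    rw [subgraph_adj_iff_of_iso_top e₁, subgraph_adj_iff_of_iso_top e₂, hverts]
  · rintro S ⟨e⟩
    refine ⟨(⊤ : G.Subgraph).induce S, ⟨⟨e.symm.toEquiv, fun {x y} => ?_⟩⟩, rfl⟩
    rw [← e.symm.map_rel_iff]
    exact ⟨fun h => h.2.2, fun h => ⟨(e.symm x).2, (e.symm y).2, h⟩⟩

lemma card_iso_top [Fintype W] :
    Nat.card ((⊤ : SimpleGraph W) ≃g (⊤ : SimpleGraph W)) = (Fintype.card W).factorial := by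
  classical
  rw [← Fintype.card_perm, ← Nat.card_eq_fintype_card]
  exact Nat.card_congr
    ⟨RelIso.toEquiv, SimpleGraph.Iso.completeGraph, fun _ => rfl, fun _ => rfl⟩

lemma card_iso_cycleGraph_four :
    Nat.card (SimpleGraph.cycleGraph 4 ≃g SimpleGraph.cycleGraph 4) = 8 := by
  let e : (SimpleGraph.cycleGraph 4 ≃g SimpleGraph.cycleGraph 4) ≃ {σ : Equiv.Perm (Fin 4) //
      ∀ a b, (SimpleGraph.cycleGraph 4).Adj (σ a) (σ b) ↔ (SimpleGraph.cycleGraph 4).Adj a b} :=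
    ⟨fun φ => ⟨φ.toEquiv, fun _ _ => φ.map_rel_iff⟩, fun σ => ⟨σ.1, fun {a b} => σ.2 a b⟩,
      fun _ => rfl, fun _ => rfl⟩
  rw [Nat.card_congr e, Nat.card_eq_fintype_card]
  decide +kernel

lemma sum_fin_succ_arrow [Fintype V] (n : ℕ) (F : (Fin (n + 1) → V) → ℚ) :
    ∑ f, F f = ∑ v, ∑ g : Fin n → V, F (Matrix.vecCons v g) := by
  rw [← (Fin.consEquiv fun _ => V).sum_comp, Fintype.sum_prod_type]
  rfl

lemma sum_fin_three_arrow [Fintype V] (F : (Fin 3 → V) → ℚ) :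
    ∑ f, F f = ∑ i, ∑ j, ∑ k, F ![i, j, k] := by
  simp only [sum_fin_succ_arrow, Fintype.sum_unique, Subsingleton.elim default (![] : Fin 0 → V)]

lemma sum_fin_four_arrow [Fintype V] (F : (Fin 4 → V) → ℚ) :
    ∑ f, F f = ∑ i, ∑ j, ∑ k, ∑ l, F ![i, j, k, l] := by
  simp only [sum_fin_succ_arrow, Fintype.sum_unique, Subsingleton.elim default (![] : Fin 0 → V)]

lemma card_embedding_eq_sum [Fintype V] [Fintype W] [DecidableEq W] (G : SimpleGraph V)
    (H : SimpleGraph W) {P : (W → V) → Prop} [DecidablePred P]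
    (hP : ∀ f, P f ↔ Function.Injective f ∧ ∀ a b, G.Adj (f a) (f b) ↔ H.Adj a b) :
    (Nat.card (H ↪g G) : ℚ) = ∑ f, if P f then 1 else 0 := by
  let e : (H ↪g G) ≃ {f : W → V // P f} :=
    ⟨fun φ => ⟨φ, (hP φ).2 ⟨φ.injective, fun _ _ => φ.map_rel_iff⟩⟩,
      fun f => ⟨⟨f.1, ((hP f.1).1 f.2).1⟩, fun {a b} => ((hP f.1).1 f.2).2 a b⟩,
      fun _ => rfl, fun _ => rfl⟩
  rw [Nat.card_congr e, Nat.card_eq_fintype_card, Fintype.card_subtype, sum_boole]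

lemma forall_lt_adj_iff_top [LinearOrder W] (G : SimpleGraph V) (f : W → V) :
    (∀ a b, a < b → G.Adj (f a) (f b)) ↔
      Function.Injective f ∧ ∀ a b, G.Adj (f a) (f b) ↔ (⊤ : SimpleGraph W).Adj a b := by
  refine ⟨fun h => ?_, fun h a b hab => (h.2 a b).2 hab.ne⟩
  have hadj : ∀ a b, a ≠ b → G.Adj (f a) (f b) := fun a b hab =>
    hab.lt_or_gt.elim (h a b) fun hba => (h b a hba).symm
  refine ⟨fun a b hab => by_contra fun hne => (hadj a b hne).ne hab, fun a b => ⟨?_, hadj a b⟩⟩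
  rintro hab rfl
  exact G.irrefl hab

lemma cycle_adj_iff_cycleGraph_four (G : SimpleGraph V) (f : Fin 4 → V) :
    ((Gᶜ.Adj (f 0) (f 2) ∧ Gᶜ.Adj (f 1) (f 3)) ∧ G.Adj (f 0) (f 1) ∧ G.Adj (f 0) (f 3) ∧
        G.Adj (f 2) (f 1) ∧ G.Adj (f 2) (f 3)) ↔
      Function.Injective f ∧ ∀ a b, G.Adj (f a) (f b) ↔ (SimpleGraph.cycleGraph 4).Adj a b := by
  constructor
  · simp only [SimpleGraph.compl_adj]
    rintro ⟨⟨⟨h02, h02'⟩, ⟨h13, h13'⟩⟩, h01, h03, h21, h23⟩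
    have h10 := h01.symm
    have h30 := h03.symm
    have h12 := h21.symm
    have h32 := h23.symm
    have h20' := mt (G.adj_symm (u := f 2) (v := f 0)) h02'
    have h31' := mt (G.adj_symm (u := f 3) (v := f 1)) h13'
    refine ⟨fun a b hab => ?_, fun a b => ?_⟩
    · have := h01.ne
      have := h03.ne
      have := h21.ne
      have := h23.ne
      fin_cases a <;> fin_cases b <;> simp_all [eq_comm]
    · fin_cases a <;> fin_cases b <;>
        first
        | exact iff_of_true ‹_› (by decide)
        | exact iff_of_false ‹_› (by decide)
        | exact iff_of_false G.irrefl (by decide)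
  · rintro ⟨hinj, hadj⟩
    simp only [SimpleGraph.compl_adj, hadj, hinj.ne_iff, ne_eq]
    decide

variable [Fintype V] (G : SimpleGraph V) [DecidableRel G.Adj]

lemma copyCount_cycleGraph_three :
    (G.copyCount (SimpleGraph.cycleGraph 3) : ℚ) = triangleSum G := by
  have hsum := card_embedding_eq_sum G ⊤ (forall_lt_adj_iff_top (W := Fin 3) G)
  have hterm : ∀ f : Fin 3 → V,
      (if ∀ a b, a < b → G.Adj (f a) (f b) then (1 : ℚ) else 0) =
      𝐀[G] (f 0) (f 1) * 𝐀[G] (f 0) (f 2) * 𝐀[G] (f 1) (f 2) := by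
    intro f
    simp only [SimpleGraph.adjMatrix_apply, ite_zero_mul_ite_zero, mul_one]
    exact if_congr (by simp [Fin.forall_fin_succ, and_assoc]) rfl rfl
  rw [card_embedding, ← copyCount_top, card_iso_top, sum_congr rfl fun f _ => hterm f,
    sum_fin_three_arrow, ← SimpleGraph.cycleGraph_three_eq_top] at hsum
  push_cast [Fintype.card_fin, Nat.factorial] at hsum
  rw [triangleSum, one_div, eq_inv_mul_iff_mul_eq₀ (by norm_num), mul_comm]
  exact hsum

lemma copyCount_completeGraph_four :
    (G.copyCount (SimpleGraph.completeGraph (Fin 4)) : ℚ) = fourCliqueSum G := by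
  have hsum := card_embedding_eq_sum G ⊤ (forall_lt_adj_iff_top (W := Fin 4) G)
  have hterm : ∀ f : Fin 4 → V,
      (if ∀ a b, a < b → G.Adj (f a) (f b) then (1 : ℚ) else 0) =
      𝐀[G] (f 0) (f 1) * 𝐀[G] (f 0) (f 2) * 𝐀[G] (f 0) (f 3) *
        (𝐀[G] (f 1) (f 2) * 𝐀[G] (f 1) (f 3) * 𝐀[G] (f 2) (f 3)) := by
    intro f
    simp only [SimpleGraph.adjMatrix_apply, ite_zero_mul_ite_zero, mul_one]
    exact if_congr (by simp [Fin.forall_fin_succ, and_assoc]) rfl rfl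
  rw [card_embedding, ← copyCount_top, card_iso_top, sum_congr rfl fun f _ => hterm f,
    sum_fin_four_arrow] at hsum
  push_cast [Fintype.card_fin, Nat.factorial] at hsum
  rw [fourCliqueSum, one_div, eq_inv_mul_iff_mul_eq₀ (by norm_num), mul_comm]
  exact hsum

lemma inducedCount_cycleGraph_four [DecidableEq V] :
    (inducedCount G (SimpleGraph.cycleGraph 4) : ℚ) = inducedFourCycleSum G := by
  have hsum := card_embedding_eq_sum G (SimpleGraph.cycleGraph 4) (cycle_adj_iff_cycleGraph_four G)
  have hterm : ∀ f : Fin 4 → V,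
      (if (Gᶜ.Adj (f 0) (f 2) ∧ Gᶜ.Adj (f 1) (f 3)) ∧ G.Adj (f 0) (f 1) ∧ G.Adj (f 0) (f 3) ∧
        G.Adj (f 2) (f 1) ∧ G.Adj (f 2) (f 3) then (1 : ℚ) else 0) =
      𝐀[Gᶜ] (f 0) (f 2) * 𝐀[Gᶜ] (f 1) (f 3) *
        (𝐀[G] (f 0) (f 1) * 𝐀[G] (f 0) (f 3) * 𝐀[G] (f 2) (f 1) * 𝐀[G] (f 2) (f 3)) := by
    intro f
    simp only [SimpleGraph.adjMatrix_apply, ite_zero_mul_ite_zero, mul_one, and_assoc]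
  rw [card_embedding, card_iso_cycleGraph_four, sum_congr rfl fun f _ => hterm f,
    sum_fin_four_arrow] at hsum
  push_cast at hsum
  rw [inducedFourCycleSum, one_div, eq_inv_mul_iff_mul_eq₀ (by norm_num), mul_comm,
    sum_congr rfl fun i _ => sum_comm]
  exact hsum

lemma card_edgeFinset_eq_edgeSum : (#G.edgeFinset : ℚ) = edgeSum G := by
  have hdegree : ∀ i, ∑ j, 𝐀[G] i j = G.degree i := fun i => by
    simp [SimpleGraph.adjMatrix_apply, SimpleGraph.neighborFinset_eq_filter,
      ← G.card_neighborFinset_eq_degree]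
  simp only [edgeSum, hdegree]
  rw [← Nat.cast_sum, G.sum_degrees_eq_twice_card_edges]
  push_cast
  ring

end SubgraphCounts

section IncreasingSums

variable {ι : Type*} [LinearOrder ι]

lemma filter_lt_insert_of_forall_lt {a : ι} {S : Finset ι} (ha : ∀ j ∈ S, a < j) {i : ι}
    (hi : i ∈ S) : {j ∈ insert a S | i < j} = {j ∈ S | i < j} := by
  rw [filter_insert, if_neg (ha i hi).not_gt]

lemma filter_lt_insert_self_of_forall_lt {a : ι} {S : Finset ι} (ha : ∀ j ∈ S, a < j) :
    {j ∈ insert a S | a < j} = S := by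
  rw [filter_insert, if_neg (lt_irrefl a), filter_true_of_mem ha]

lemma sum_lt_mul (s : ι → ℚ) (S : Finset ι) :
    ∑ i ∈ S, ∑ j ∈ S with i < j, s i * s j =
      ((∑ i ∈ S, s i) ^ 2 - ∑ i ∈ S, s i ^ 2) / 2 := by
  induction S using induction_on_min with
  | empty => simp
  | insert a S ha ih =>
    have haS : a ∉ S := fun h => (ha a h).false
    have htail : ∀ i ∈ S, ∑ j ∈ insert a S with i < j, s i * s j =
        ∑ j ∈ S with i < j, s i * s j :=
      fun i hi => by rw [filter_lt_insert_of_forall_lt ha hi]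
    rw [sum_insert haS, filter_lt_insert_self_of_forall_lt ha, sum_congr rfl htail, ih, ← mul_sum,
      sum_insert haS, sum_insert haS]
    ring

lemma sum_lt_lt_mul (s : ι → ℚ) (S : Finset ι) :
    ∑ i ∈ S, ∑ j ∈ S with i < j, ∑ k ∈ S with j < k, s i * s j * s k =
      ((∑ i ∈ S, s i) ^ 3 - 3 * (∑ i ∈ S, s i) * ∑ i ∈ S, s i ^ 2 + 2 * ∑ i ∈ S, s i ^ 3) / 6 := by
  induction S using induction_on_min with
  | empty => simp
  | insert a S ha ih =>
    have haS : a ∉ S := fun h => (ha a h).false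
    have htail : ∀ i ∈ S, ∑ j ∈ insert a S with i < j, ∑ k ∈ insert a S with j < k,
        s i * s j * s k = ∑ j ∈ S with i < j, ∑ k ∈ S with j < k, s i * s j * s k :=
      fun i hi => by
        rw [filter_lt_insert_of_forall_lt ha hi]
        exact sum_congr rfl fun j hj => by
          rw [filter_lt_insert_of_forall_lt ha (mem_filter.1 hj).1]
    have hhead : ∑ j ∈ insert a S with a < j, ∑ k ∈ insert a S with j < k, s a * s j * s k =
        s a * ∑ j ∈ S, ∑ k ∈ S with j < k, s j * s k := by
      simp only [filter_lt_insert_self_of_forall_lt ha, mul_sum, mul_assoc]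
      exact sum_congr rfl fun j hj => by rw [filter_lt_insert_of_forall_lt ha hj]
    rw [sum_insert haS, hhead, sum_congr rfl htail, ih, sum_lt_mul, sum_insert haS,
      sum_insert haS, sum_insert haS]
    ring

lemma sum_lt_eq_half_sum [Fintype ι] {f : ι → ι → ℚ} (hf : ∀ i j, f i j = f j i) :
    ∑ i, ∑ j with i < j, f i j = 1 / 2 * ((∑ i, ∑ j, f i j) - ∑ i, f i i) := by
  have hsplit : ∀ i j, f i j = (if i < j then f i j else 0) + (if j < i then f i j else 0)
      + (if i = j then f i j else 0) := by
    intro i j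
    rcases lt_trichotomy i j with h | rfl | h
    · simp [h, h.not_gt, h.ne]
    · simp
    · simp [h, h.not_gt, h.ne']
  have hswap : (∑ i, ∑ j, if j < i then f i j else 0) = ∑ i, ∑ j, if i < j then f i j else 0 := by
    rw [sum_comm]
    simp only [hf]
  have hsum := sum_congr (s₁ := univ) rfl fun i _ => sum_congr (s₁ := univ) rfl fun j _ =>
    hsplit i j
  simp only [sum_add_distrib, hswap, sum_ite_eq, mem_univ, if_true] at hsum
  simp only [sum_filter]
  linarith

end IncreasingSums

section PaperFormula

variable {V : Type*} [Fintype V]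

lemma sum_neighborFinset (G : SimpleGraph V) [DecidableRel G.Adj] (i : V) (f : V → ℚ) :
    ∑ j ∈ G.neighborFinset i, f j = ∑ j, 𝐀[G] i j * f j := by
  simp [G.neighborFinset_eq_filter, sum_filter, SimpleGraph.adjMatrix_apply]

lemma sum_neighborFinset_inter [DecidableEq V] (G : SimpleGraph V) [DecidableRel G.Adj] (i j : V)
    (f : V → ℚ) : ∑ k ∈ G.neighborFinset i ∩ G.neighborFinset j, f k =
      ∑ k, 𝐀[G] i k * 𝐀[G] j k * f k := by
  rw [← filter_mem_eq_inter, sum_filter, sum_neighborFinset]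
  simp [SimpleGraph.adjMatrix_apply]

lemma cast_choose_three (m : ℕ) : (m.choose 3 : ℚ) = m * (m - 1) * (m - 2) / 6 := by
  induction m with
  | zero => simp
  | succ m ih =>
    rw [Nat.choose_succ_succ, Nat.cast_add, ih, Nat.cast_choose_two]
    push_cast
    ring

lemma A5_eq_subgraphSums (G : SimpleGraph V) [DecidableRel G.Adj] (r : V → Finset ℕ) : A5 G r =
    (edgeSum G * (edgeSum G - 1) / 2 - triangleSum G) * ∑ i, (#(r i) : ℚ) := by
  rw [A5, Nat.cast_choose_two, copyCount_cycleGraph_three, card_edgeFinset_eq_edgeSum]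

variable [LinearOrder V] (G : SimpleGraph V) [DecidableRel G.Adj] (r : V → Finset ℕ)

lemma sum_lt_adj_eq_half_sum {f : V → V → ℚ} (hf : ∀ i j, f i j = f j i) :
    ∑ i, ∑ j with i < j ∧ G.Adj i j, f i j = 1 / 2 * ∑ i, ∑ j, 𝐀[G] i j * f i j := by
  have hsum := sum_lt_eq_half_sum (f := fun i j => 𝐀[G] i j * f i j) fun i j => by
    rw [hf, adjMatrix_symm]
  simp only [adjMatrix_self, zero_mul, sum_const_zero, sub_zero] at hsum
  rw [← hsum]
  simp [← filter_filter, sum_filter, SimpleGraph.adjMatrix_apply]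

lemma A0_eq_subgraphSums : A0 G = edgeSum G * (edgeSum G - 1) * (edgeSum G - 2) / 6
    - (edgeSum G - 2) * triangleSum G - inducedFourCycleSum G + 2 * fourCliqueSum G := by
  rw [A0, cast_choose_three, copyCount_cycleGraph_three, inducedCount_cycleGraph_four,
    copyCount_completeGraph_four, card_edgeFinset_eq_edgeSum]

lemma A1_eq_powerSums : A1 r = ((∑ i, (#(r i) : ℚ)) ^ 3
    - 3 * (∑ i, (#(r i) : ℚ)) * (∑ i, (#(r i) : ℚ) ^ 2) + 2 * ∑ i, (#(r i) : ℚ) ^ 3) / 6 :=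
  sum_lt_lt_mul _ univ

lemma A2_eq_powerSums : A2 G r = (edgeSum G - 1) *
    (((∑ i, (#(r i) : ℚ)) ^ 2 - ∑ i, (#(r i) : ℚ) ^ 2) / 2) := by
  rw [A2, card_edgeFinset_eq_edgeSum, sum_lt_mul]

lemma A3_eq_adjMatrix_sum : A3 G r = ((∑ i, (#(r i) : ℚ)) ^ 2 - ∑ i, (#(r i) : ℚ) ^ 2) / 2
    - 1 / 2 * ∑ i, ∑ j, 𝐀[G] i j * (#(r i) * #(r j)) := by
  rw [A3, ← sum_lt_mul, ← sum_lt_adj_eq_half_sum G fun i j => mul_comm _ _, eq_sub_iff_add_eq,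
    ← sum_add_distrib]
  refine sum_congr rfl fun i _ => ?_
  simp only [← filter_filter]
  rw [add_comm, sum_filter_add_sum_filter_not]

lemma A4_eq_adjMatrix_sum : A4 G r =
    1 / 2 * (∑ i, ∑ j, 𝐀[G] i j * (#(r i ∩ r j) * (#(r i) + #(r j))))
    - (∑ i, (#(r i) : ℚ)) * (1 / 2 * ∑ i, ∑ j, 𝐀[G] i j * #(r i ∩ r j)) := by
  have hrest : ∀ i j, i ≠ j → ∑ k with k ≠ i ∧ k ≠ j, (#(r k) : ℚ) =
      (∑ k, (#(r k) : ℚ)) - (#(r i) + #(r j)) := by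
    intro i j hij
    have hcompl : ({k | k ≠ i ∧ k ≠ j} : Finset V) = univ \ {i, j} := by ext; simp
    rw [hcompl, sum_sdiff_eq_sub (subset_univ _), sum_pair hij]
  rw [A4, ← sum_lt_adj_eq_half_sum G fun i j => by rw [inter_comm, add_comm],
    ← sum_lt_adj_eq_half_sum G fun i j => by rw [inter_comm], mul_sum, ← sum_sub_distrib,
    ← sum_neg_distrib]
  refine sum_congr rfl fun i _ => ?_
  rw [mul_sum, ← sum_sub_distrib, ← sum_neg_distrib]
  refine sum_congr rfl fun j hj => ?_
  rw [hrest i j (mem_filter.1 hj).2.1.ne]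
  ring

lemma A6_eq_adjMatrix_sum : A6 G r =
    -(edgeSum G - 1) * (1 / 2 * ∑ i, ∑ j, 𝐀[G] i j * #(r i ∩ r j)) := by
  rw [A6, card_edgeFinset_eq_edgeSum, sum_lt_adj_eq_half_sum G fun i j => by rw [inter_comm]]

lemma A7'_eq_adjMatrix_sum : A7' G r = 1 / 2 * ∑ i, ∑ j, ∑ k,
    𝐀[G] i j * 𝐀[G] i k * 𝐀[G] j k * #(r j ∩ r k) := by
  have hcommon : ∀ i j, (#(G.neighborFinset i ∩ G.neighborFinset j) : ℚ) =
      ∑ k, 𝐀[G] i k * 𝐀[G] j k := fun i j => by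
    simpa using sum_neighborFinset_inter G i j fun _ => 1
  rw [A7', sum_lt_adj_eq_half_sum G fun i j => by rw [inter_comm, inter_comm (r i)]]
  simp only [hcommon, sum_mul, mul_sum]
  rw [sum_comm_cycle]
  refine sum_congr rfl fun i _ => sum_congr rfl fun j _ => sum_congr rfl fun k _ => ?_
  rw [adjMatrix_symm G j i, adjMatrix_symm G k i]
  ring

lemma A7''_eq_adjMatrix_sum : A7'' G r =
    1 / 2 * (∑ i, ∑ j, 𝐀[G] i j * #(r j))
    - 1 / 2 * ∑ i, ∑ j, ∑ k, 𝐀[G] i j * 𝐀[G] i k * #(r j ∩ r k) := by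
  have hcherry : ∀ i, ∑ j ∈ G.neighborFinset i, ∑ k ∈ G.neighborFinset i with j < k,
      (#(r j ∩ r k) : ℚ) = 1 / 2 * ((∑ j, ∑ k, 𝐀[G] i j * 𝐀[G] i k * #(r j ∩ r k))
        - ∑ j, 𝐀[G] i j * #(r j)) := by
    intro i
    have hsum := sum_lt_eq_half_sum (f := fun j k => 𝐀[G] i j * 𝐀[G] i k * #(r j ∩ r k))
      fun j k => by rw [inter_comm, mul_comm (𝐀[G] i j)]
    simp only [adjMatrix_mul_self, inter_self] at hsum
    rw [← hsum, sum_neighborFinset]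
    refine sum_congr rfl fun j _ => ?_
    rw [sum_filter, sum_neighborFinset, sum_filter, mul_sum]
    simp
  simp only [A7'', hcherry, ← mul_sum, sum_sub_distrib]
  ring

lemma sum_neighborFinset_union_of_adj {i j : V} (hij : G.Adj i j) :
    ∑ k ∈ G.neighborFinset i ∪ G.neighborFinset j with k ≠ i ∧ k ≠ j,
      (#(r i ∩ r j ∩ r k) : ℚ) =
    (∑ k, 𝐀[G] i k * #(r i ∩ r j ∩ r k)) + (∑ k, 𝐀[G] j k * #(r i ∩ r j ∩ r k))
      - (∑ k, 𝐀[G] i k * 𝐀[G] j k * #(r i ∩ r j ∩ r k)) - 2 * #(r i ∩ r j) := by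
  have hmem : ({k ∈ G.neighborFinset i ∪ G.neighborFinset j | k ≠ i ∧ k ≠ j} : Finset V) =
      (G.neighborFinset i ∪ G.neighborFinset j) \ {i, j} := by ext; simp
  have hends : ({i, j} : Finset V) ⊆ G.neighborFinset i ∪ G.neighborFinset j := by
    simp [insert_subset_iff, hij, hij.symm]
  rw [hmem, sum_sdiff_eq_sub hends, sum_pair hij.ne, inter_right_comm, inter_self, inter_assoc,
    inter_self, ← sum_neighborFinset, ← sum_neighborFinset, ← sum_neighborFinset_inter,
    ← sum_union_inter]
  ring

lemma A8'_eq_adjMatrix_sum : A8' G r =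
    1 / 2 * (∑ i, ∑ j, ∑ k, 𝐀[G] i j * 𝐀[G] i k * #(r i ∩ r j ∩ r k))
    - 1 / 2 * (∑ i, ∑ j, 𝐀[G] i j * #(r i ∩ r j))
    - 1 / 4 * ∑ i, ∑ j, ∑ k, 𝐀[G] i j * 𝐀[G] i k * 𝐀[G] j k * #(r i ∩ r j ∩ r k) := by
  have hswap : ∑ i, ∑ j, ∑ k, 𝐀[G] i j * 𝐀[G] j k * (#(r i ∩ r j ∩ r k) : ℚ) =
      ∑ i, ∑ j, ∑ k, 𝐀[G] i j * 𝐀[G] i k * #(r i ∩ r j ∩ r k) := by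
    rw [sum_comm]
    refine sum_congr rfl fun i _ => sum_congr rfl fun j _ => sum_congr rfl fun k _ => ?_
    rw [adjMatrix_symm G j i, inter_comm (r j)]
  have hterm : ∀ i j, 𝐀[G] i j *
      ∑ k ∈ G.neighborFinset i ∪ G.neighborFinset j with k ≠ i ∧ k ≠ j,
        (#(r i ∩ r j ∩ r k) : ℚ) =
      (∑ k, 𝐀[G] i j * 𝐀[G] i k * #(r i ∩ r j ∩ r k))
      + (∑ k, 𝐀[G] i j * 𝐀[G] j k * #(r i ∩ r j ∩ r k))
      - (∑ k, 𝐀[G] i j * 𝐀[G] i k * 𝐀[G] j k * #(r i ∩ r j ∩ r k))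
      - 2 * (𝐀[G] i j * #(r i ∩ r j)) := by
    intro i j
    by_cases hij : G.Adj i j
    · rw [sum_neighborFinset_union_of_adj G r hij]
      simp only [SimpleGraph.adjMatrix_apply, if_pos hij, one_mul]
    · simp [hij, SimpleGraph.adjMatrix_apply]
  rw [A8', sum_lt_adj_eq_half_sum G fun i j => by
    rw [union_comm, inter_comm (r i)]; simp only [and_comm]]
  simp only [hterm, sum_sub_distrib, sum_add_distrib, hswap, ← mul_sum]
  ring

lemma A8''_eq_adjMatrix_sum : A8'' G r = 1 / 12 * ∑ i, ∑ j, ∑ k,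
    𝐀[G] i j * 𝐀[G] i k * 𝐀[G] j k * #(r i ∩ r j ∩ r k) := by
  rw [A8'', sum_lt_adj_eq_half_sum G fun i j => by rw [inter_comm, inter_comm (r i)]]
  simp only [sum_neighborFinset_inter, mul_sum]
  refine sum_congr rfl fun i _ => sum_congr rfl fun j _ => sum_congr rfl fun k _ => ?_
  ring

theorem formula_eq_cumulants : A0 G
    + (A1 r + A2 G r + A3 G r + A4 G r + A5 G r + A6 G r + A7 G r + A8 G r) =
    cumulantOne G r ^ 3 / 6 - cumulantOne G r * cumulantTwo G r + cumulantThree G r := by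
  have hedge : ∑ i, ∑ j, 𝐀[G] i j * edgeWeight r i j =
      (∑ i, ∑ j, 𝐀[G] i j * (#(r i ∩ r j) * (#(r i) + #(r j))))
      - (∑ i, ∑ j, 𝐀[G] i j * (#(r i) * #(r j)))
      + ∑ i, ∑ j, 𝐀[G] i j * #(r j) := by
    simp only [edgeWeight, mul_add, mul_sub, sum_add_distrib, sum_sub_distrib]
  have hcherry : ∑ i, ∑ j, ∑ k, 𝐀[G] i j * 𝐀[G] i k * cherryWeight r i j k =
      (∑ i, ∑ j, ∑ k, 𝐀[G] i j * 𝐀[G] i k * #(r j ∩ r k))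
      - ∑ i, ∑ j, ∑ k, 𝐀[G] i j * 𝐀[G] i k * #(r i ∩ r j ∩ r k) := by
    simp only [cherryWeight, mul_sub, sum_sub_distrib]
  have htriangle : ∑ i, ∑ j, ∑ k, 𝐀[G] i j * 𝐀[G] i k * 𝐀[G] j k * triangleWeight r i j k =
      (∑ i, ∑ j, ∑ k, 𝐀[G] i j * 𝐀[G] i k * 𝐀[G] j k * #(r j ∩ r k)) / 2
      - (∑ i, ∑ j, ∑ k, 𝐀[G] i j * 𝐀[G] i k * 𝐀[G] j k * #(r i ∩ r j ∩ r k)) / 6 := by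
    simp only [triangleWeight, mul_sub, sum_sub_distrib, mul_div_assoc', sum_div]
  rw [A7, A8, A0_eq_subgraphSums, A1_eq_powerSums, A2_eq_powerSums, A3_eq_adjMatrix_sum,
    A4_eq_adjMatrix_sum, A5_eq_subgraphSums, A6_eq_adjMatrix_sum, A7'_eq_adjMatrix_sum,
    A7''_eq_adjMatrix_sum, A8'_eq_adjMatrix_sum, A8''_eq_adjMatrix_sum,
    cumulantOne, cumulantTwo, cumulantThree, hedge, hcherry, htriangle]
  ring

end PaperFormula

section Coefficients

variable {V : Type*} [Fintype V] {r : V → Finset ℕ}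

lemma subset_Icc_maxForbidden (hr : ∀ v, ∀ c ∈ r v, 1 ≤ c) (v : V) :
    r v ⊆ Icc 1 (maxForbidden r) := fun c hc =>
  mem_Icc.2 ⟨hr v c hc, le_sup (f := id) (mem_biUnion.2 ⟨v, mem_univ v, hc⟩)⟩

variable [DecidableEq V] {G : SimpleGraph V} [DecidableRel G.Adj]

lemma IsExpansion.hasCoefficients {b : ℕ → ℤ} (hb : IsExpansion G r (maxForbidden r) b) :
    HasCoefficients G r fun i => b (Fintype.card V - i) := by
  intro x hx
  rw [hb.count_eq x hx, alternatingSum, ← sum_range_reflect,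
    Fin.sum_univ_eq_sum_range fun i =>
      (-1) ^ (Fintype.card V - i) * b (Fintype.card V - i) * (x : ℤ) ^ i]
  refine sum_congr rfl fun i hi => ?_
  rw [Nat.add_sub_cancel, Nat.sub_sub_self (mem_range_succ_iff.1 hi)]

lemma HasCoefficients.unique {a b : Fin (Fintype.card V + 1) → ℤ} (ha : HasCoefficients G r a)
    (hb : HasCoefficients G r b) : a = b := by
  let P (d : Fin (Fintype.card V + 1) → ℤ) : Polynomial ℤ := ∑ i : Fin (Fintype.card V + 1),
    Polynomial.C ((-1) ^ (Fintype.card V - (i : ℕ)) * d i) * Polynomial.X ^ (i : ℕ)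
  have heval : ∀ d, HasCoefficients G r d → ∀ x : ℕ, maxForbidden r ≤ x →
      (P d).eval (x : ℤ) = restrainedCount G r x := fun d hd x hx => by
    simp [P, hd x hx, Polynomial.eval_finsetSum]
  have hcoeff : ∀ d (i : Fin (Fintype.card V + 1)),
      (P d).coeff i = (-1) ^ (Fintype.card V - (i : ℕ)) * d i := fun d i => by
    simp only [P, Polynomial.finsetSum_coeff, Polynomial.coeff_C_mul, Polynomial.coeff_X_pow,
      Fin.val_inj, mul_ite, mul_one, mul_zero, sum_ite_eq, mem_univ, if_true]
  have hP : P a = P b := by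
    refine Polynomial.eq_of_infinite_eval_eq _ _ (Set.Infinite.mono ?_
      ((Set.Ici_infinite (maxForbidden r)).image (Nat.cast_injective (R := ℤ)).injOn))
    rintro _ ⟨x, hx, rfl⟩
    exact (heval a ha x hx).trans (heval b hb x hx).symm
  funext i
  refine mul_left_cancel₀ (pow_ne_zero (Fintype.card V - (i : ℕ)) (neg_ne_zero.2 one_ne_zero)) ?_
  rw [← hcoeff, ← hcoeff, hP]

end Coefficients

end RestrainedColouring

theorem mainTheorem8 {V : Type*} [Fintype V] [LinearOrder V]
    (G : SimpleGraph V) [DecidableRel G.Adj] (hn : 3 ≤ Fintype.card V)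
    (r : V → Finset ℕ) (hr : ∀ v, ∀ c ∈ r v, 1 ≤ c) :
    (∃! a : Fin (Fintype.card V + 1) → ℤ, RestrainedColouring.HasCoefficients G r a) ∧
    ∀ a : Fin (Fintype.card V + 1) → ℤ, RestrainedColouring.HasCoefficients G r a →
      (a ⟨Fintype.card V - 3, by omega⟩ : ℚ) =
        RestrainedColouring.A0 G + RestrainedColouring.A1 r + RestrainedColouring.A2 G r
          + RestrainedColouring.A3 G r + RestrainedColouring.A4 G r + RestrainedColouring.A5 G r
          + RestrainedColouring.A6 G r + RestrainedColouring.A7 G r + RestrainedColouring.A8 G r := by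
  obtain ⟨b, hb, hcumulants⟩ := RestrainedColouring.exists_isExpansion_hasCumulants G
    (RestrainedColouring.subset_Icc_maxForbidden hr)
  refine ⟨⟨_, hb.hasCoefficients, fun a ha => ha.unique hb.hasCoefficients⟩, fun a ha => ?_⟩
  have hthree : a ⟨Fintype.card V - 3, by omega⟩ = b 3 := by
    rw [ha.unique hb.hasCoefficients]
    exact congrArg b (Nat.sub_sub_self hn)
  rw [hthree, hcumulants.coeff_three, ← RestrainedColouring.formula_eq_cumulants]
  ring
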